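/- **Setting.** Consider the plant $\dot x=f(x)+g(x)u$, $z=q(x)$, with state $x\in\mathcal X\subset\mathbb R^{n_x}$, input $u\in\mathcal U\subset\mathbb R^{n_u}$ and estimate $\hat x\in\hat{\mathcal X}\subset\mathbb R^{n_x}$, where $\mathcal X$, $\mathcal U\ne\varnothing$ and $\hat{\mathcal X}$ are compact, $0\in\mathcal X$, $f(0)=0$, $q(0)=0$, and $f,g,q$ are $C^2$ on a neighbourhood of $\mathcal X\cup\hat{\mathcal X}$. Put $C(\hat x)=\frac{\partial q}{\partial x}(\hat x)$ and $A(\hat x,u)=\frac{\partial f}{\partial x}(\hat x)+\frac{\partial g}{\partial x}(\hat x)u$. Let $\kappa\ge 0$, and let $Q$ and $R\ge \underline r I$ ($\underline r>0$) be symmetric positive definite. The observer is $$\dot{\hat x}=f(\hat x)+g(\hat x)u+P C^\top R^{-1}[z-q(\hat x)],\qquad \dot P=\kappa P+AP+PA^\top-PC^\top R^{-1}CP+Q ,$$ and $S=P^{-1}$. A *trajectory* on $\mathcal I=[0,t_{\max})$ ($0<t_{\max}\le\infty$) is a solution $(u,x,\hat x,P)$ of these equations ($x,\hat x,P$ continuous,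 the equations holding except at times from a locally finite set) with $x(t)\in\mathcal X$, $u(t)\in\mathcal U$, $\hat x(t)\in\hat{\mathcal X}$ for $t\in\mathcal I$. The observer has a known error bound: constants $\varepsilon,\eta>0$ and $\theta>\kappa/2$ are given such that $\|x(t)-\hat x(t)\|\le\eta\|x(0)-\hat x(0)\|e^{-\theta t}$ on $\mathcal I$ for all trajectories with $\|x(0)-\hat x(0)\|<\varepsilon$ and $\underline pI\le P(t)\le\bar pI$ on $\mathcal I$, where $\underline p,\bar p>0$ are fixed. Fix $x_0$, $\hat x_0$ and put $M_0=\eta\|x_0-\hat x_0\|$. Let $h$ be a CBF: $h$ is $C^2$ on a neighbourhood of $\mathcal X\cup\hat{\mathcal X}$, the safe set $\mathcal S=\{x\in\mathcal X:h(x)\ge0\}$ has non-empty interior, and for a constant $0<\alpha\le\theta$ $$\sup_{u\in\mathcal U}\bigl(L_fh(x)+L_gh(x)u-\underline r^{-1}\bar p K_hK_q^2M_0\bigr)\ge-\alpha h(x)\qquad(x\in\mathcal S),$$ where $K_h,K_q$ are Lipschitz constants of $h,q$ on $\mathcal X\cup\hat{\mathcal X}$ and $\|\partial q/\partial x\|\le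 K_q$ there. Assume relative degree one: $L_gh\ne0$ on $\mathcal X\cup\hat{\mathcal X}$. Assume $x_0\in\mathcal S$, $h(x_0)\ge 2K_hM_0$, $\hat x_0\in\hat{\mathcal X}$, $\|x_0-\hat x_0\|<\varepsilon$. Let $\pi_n$ be Lipschitz on $\hat{\mathcal X}$, $c_1\ge0$ and $\Delta t>0$. Let $P$ be piecewise continuous on $\mathcal I$ with $\underline pI\le P(t)\le\bar pI$, let $S(t)=P(t)^{-1}$, and for $t\in\mathcal I$, $\hat x\in\hat{\mathcal X}$, $z\in\mathbb R^{n_z}$ consider the program $$\min_{u\in\mathbb R^{n_u}}\ \|u-\pi_n(\hat x)\|^2-c_1\lambda_{\min}\bigl(S_+(t,\hat x,u)\bigr)\quad\text{s.t.}\quad L_fh(\hat x)+L_gh(\hat x)u+\alpha h(\hat x)+\nabla h(\hat x)^\top S^{-1}(t)C^\top R^{-1}[z-q(\hat x)]\ge0, \tag{P2}$$ where $S_+=S+\Delta t\,[-\kappa S-A^\top S-SA+C^\top R^{-1}C-SQS]$, with $S=S(t)$, $A=A(\hat x,u)$, $C=C(\hat x)$, is the first-order approximation of $S(t+\Delta t)$.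 Assume that for every $t\in\mathcal I$ the eigenvalues of $S(t)$ are pairwise distinct, and that for every $(t,\hat x,z)$ those of $S_+(t,\hat x,u)$ are pairwise distinct for every control $u$ that solves (P2). **Theorem.** For all $(t,\hat x,z)\in\mathcal I\times\hat{\mathcal X}\times\mathbb R^{n_z}$, (P2) is feasible and has a unique minimizer $\pi(t,\hat x,z)$. Moreover: 1. for all $\hat x\in\hat{\mathcal X}$ and $z\in\mathbb R^{n_z}$, $t\mapsto\pi(t,\hat x,z)$ is piecewise continuous on $\mathcal I$; 2. for every bounded $Z\subset\mathbb R^{n_z}$ and every compact $J\subset\mathcal I$ on which $P$ is continuous (for instance a single time), there is $L$ such that $(\hat x,z)\mapsto\pi(t,\hat x,z)$ is $L$-Lipschitz on $\hat{\mathcal X}\times Z$ for all $t\in J$; 3. $\pi$ keeps the system safe: for every closed-loop trajectory, i.e. every trajectory $(u,x,\hat x,P)$ on $\mathcal I$ with this $P$, $u(t)=\pi(t,\hat x(t),q(x(t)))$, $x(0)=x_0$ and $\hat x(0)=\hat x_0$, one has $x(t)\in\mathcal S$ for all $t\in\mathcal I$. -/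

import Mathlib

open Set Filter Topology
open scoped NNReal Matrix

namespace ConfidenceCBF

/-- Euclidean space of dimension `n`. -/
abbrev E (n : ℕ) := EuclideanSpace ℝ (Fin n)

/-- The time interval `[0, tmax)`, where `tmax` may be `⊤`. -/
def timeInterval (tmax : EReal) : Set ℝ := {t : ℝ | 0 ≤ t ∧ (t : EReal) < tmax}

/-- Data of a control-affine plant `x' = f x + g x u`, `z = q x`, together with the sets `X`, `U`
and `Xhat` in which the state, the input and the estimated state live. -/
structure Plant (nx nu nz : ℕ) where
  f : E nx → E nx
  g : E nx → Matrix (Fin nx) (Fin nu) ℝ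
  q : E nx → E nz
  X : Set (E nx)
  U : Set (E nu)
  Xhat : Set (E nx)

/-- Design parameters of the observer. -/
structure ObserverParams (nx nz : ℕ) where
  κ : ℝ
  Q : Matrix (Fin nx) (Fin nx) ℝ
  R : Matrix (Fin nz) (Fin nz) ℝ

/-- Standing assumptions on the plant.  Being `C²` at a point means being `C²` in a neighbourhood of
it, so `f`, `g` and `q` are `C²` on an open set that contains `X ∪ Xhat`. -/
structure Plant.Standing {nx nu nz : ℕ} (sys : Plant nx nu nz) : Prop where
  isCompact_X : IsCompact sys.X
  isCompact_U : IsCompact sys.U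
  isCompact_Xhat : IsCompact sys.Xhat
  nonempty_U : sys.U.Nonempty
  zero_mem_X : (0 : E nx) ∈ sys.X
  f_zero : sys.f 0 = 0
  q_zero : sys.q 0 = 0
  f_smooth : ∀ x ∈ sys.X ∪ sys.Xhat, ContDiffAt ℝ 2 sys.f x
  g_smooth : ∀ x ∈ sys.X ∪ sys.Xhat, ∀ i j, ContDiffAt ℝ 2 (fun y => sys.g y i j) x
  q_smooth : ∀ x ∈ sys.X ∪ sys.Xhat, ContDiffAt ℝ 2 sys.q x

/-- Admissible observer parameters: `κ ≥ 0`, and `Q`, `R` symmetric positive definite. -/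
structure ObserverParams.Standing {nx nz : ℕ} (obs : ObserverParams nx nz) : Prop where
  κ_nonneg : 0 ≤ obs.κ
  Q_posDef : obs.Q.PosDef
  R_posDef : obs.R.PosDef

/-- The Jacobian matrix of `φ` at `x`. -/
noncomputable def jacobian {m n : ℕ} (φ : E n → E m) (x : E n) : Matrix (Fin m) (Fin n) ℝ :=
  Matrix.of fun i k => (fderiv ℝ φ x (EuclideanSpace.single k 1)) i

/-- The matrix `A = ∂f/∂x (xh) + (∂g/∂x (xh)) u`; the `(i, k)` entry of the second term is
`∑ j, ∂(g i j)/∂(x k) (xh) * u j`. -/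
noncomputable def matA {nx nu nz : ℕ} (sys : Plant nx nu nz) (xh : E nx) (u : E nu) :
    Matrix (Fin nx) (Fin nx) ℝ :=
  jacobian sys.f xh +
    Matrix.of fun i k =>
      ∑ j, fderiv ℝ (fun y => sys.g y i j) xh (EuclideanSpace.single k 1) * u j

/-- The matrix `C = ∂q/∂x (xh)`. -/
noncomputable def matC {nx nu nz : ℕ} (sys : Plant nx nu nz) (xh : E nx) :
    Matrix (Fin nz) (Fin nx) ℝ :=
  jacobian sys.q xh

/-- The right-hand side `f x + g x u` of the plant. -/
noncomputable def dynamics {nx nu nz : ℕ} (sys : Plant nx nu nz) (x : E nx) (u : E nu) : E nx :=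
  sys.f x + Matrix.toEuclideanLin (sys.g x) u

/-- The output injection `P Cᵀ R⁻¹ (z - q xh)`, which is `S⁻¹ Cᵀ R⁻¹ (z - q xh)` with `S = P⁻¹`. -/
noncomputable def injection {nx nu nz : ℕ} (sys : Plant nx nu nz) (obs : ObserverParams nx nz)
    (P : Matrix (Fin nx) (Fin nx) ℝ) (xh : E nx) (z : E nz) : E nx :=
  Matrix.toEuclideanLin (P * (matC sys xh)ᵀ * obs.R⁻¹) (z - sys.q xh)

/-- The right-hand side of the Riccati equation for the uncertainty `P`. -/
noncomputable def riccati {nx nu nz : ℕ} (sys : Plant nx nu nz) (obs : ObserverParams nx nz)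
    (P : Matrix (Fin nx) (Fin nx) ℝ) (xh : E nx) (u : E nu) : Matrix (Fin nx) (Fin nx) ℝ :=
  obs.κ • P + matA sys xh u * P + P * (matA sys xh u)ᵀ
    - P * (matC sys xh)ᵀ * obs.R⁻¹ * matC sys xh * P + obs.Q

/-- The first-order prediction of the confidence `S(t + Δt)` from `S = S(t)`, with the control `u`
held at the estimate `xh`. -/
noncomputable def nextS {nx nu nz : ℕ} (sys : Plant nx nu nz) (obs : ObserverParams nx nz) (Δt : ℝ)
    (S : Matrix (Fin nx) (Fin nx) ℝ) (xh : E nx) (u : E nu) : Matrix (Fin nx) (Fin nx) ℝ :=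
  S + Δt • (-(obs.κ • S) - (matA sys xh u)ᵀ * S - S * matA sys xh u
    + (matC sys xh)ᵀ * obs.R⁻¹ * matC sys xh - S * obs.Q * S)

/-- The smallest (real) eigenvalue of a matrix; used for real symmetric matrices. -/
noncomputable def lambdaMin {n : ℕ} (M : Matrix (Fin n) (Fin n) ℝ) : ℝ := sInf (spectrum ℝ M)

/-- `M` is symmetric and its `n` eigenvalues are pairwise distinct. -/
def DistinctEigenvalues {n : ℕ} (M : Matrix (Fin n) (Fin n) ℝ) : Prop :=
  ∃ hM : M.IsHermitian, Function.Injective hM.eigenvalues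

/-- `pLow • I ≤ P t ≤ pHigh • I` in the Loewner order for all `t` in `I`. -/
def UncertaintyBounds {nx : ℕ} (I : Set ℝ) (pLow pHigh : ℝ)
    (P : ℝ → Matrix (Fin nx) (Fin nx) ℝ) : Prop :=
  ∀ t ∈ I, (P t - pLow • (1 : Matrix (Fin nx) (Fin nx) ℝ)).PosSemidef ∧
    (pHigh • (1 : Matrix (Fin nx) (Fin nx) ℝ) - P t).PosSemidef

/-- `D` has only finitely many points in each `[0, T]` with `T` in `I`. -/
def LocallyFiniteIn (I D : Set ℝ) : Prop := ∀ T ∈ I, (D ∩ Icc 0 T).Finite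

/-- Piecewise continuity on an interval `I = [0, tmax)`: finitely many discontinuities in each
`[0, T]` with `T` in `I`, and one-sided limits everywhere. -/
def PiecewiseContinuous {Y : Type*} [TopologicalSpace Y] (I : Set ℝ) (φ : ℝ → Y) : Prop :=
  (∃ D : Set ℝ, LocallyFiniteIn I D ∧ ∀ t ∈ I \ D, ContinuousWithinAt φ I t) ∧
    ∀ t ∈ I, (∃ l, Tendsto φ (𝓝[I ∩ Iio t] t) (𝓝 l)) ∧ (∃ l, Tendsto φ (𝓝[I ∩ Ioi t] t) (𝓝 l))

/-- `(u, x, xh, P)` is a trajectory on `I` of the plant with its observer: the input, the state and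
the estimate stay in their sets, and `x`, `xh`, `P` are continuous and solve, except at times from a
locally finite set, the plant equation, the observer equation with output `z = q x`, and the
Riccati equation. -/
structure IsTrajectory {nx nu nz : ℕ} (sys : Plant nx nu nz) (obs : ObserverParams nx nz) (I : Set ℝ)
    (u : ℝ → E nu) (x xh : ℝ → E nx) (P : ℝ → Matrix (Fin nx) (Fin nx) ℝ) : Prop where
  u_mem : ∀ t ∈ I, u t ∈ sys.U
  x_mem : ∀ t ∈ I, x t ∈ sys.X
  xh_mem : ∀ t ∈ I, xh t ∈ sys.Xhat
  x_cont : ContinuousOn x I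
  xh_cont : ContinuousOn xh I
  P_cont : ContinuousOn P I
  ode : ∃ D : Set ℝ, LocallyFiniteIn I D ∧ ∀ t ∈ I \ D,
    HasDerivWithinAt x (dynamics sys (x t) (u t)) I t ∧
    HasDerivWithinAt xh
      (dynamics sys (xh t) (u t) + injection sys obs (P t) (xh t) (sys.q (x t))) I t ∧
    ∀ i j, HasDerivWithinAt (fun s => P s i j) (riccati sys obs (P t) (xh t) (u t) i j) I t

/-- The observer has the error bound `‖ζ t‖ ≤ η ‖ζ 0‖ exp (-θ t)` for `‖ζ 0‖ < ε`, where
`ζ = x - xh`, along all trajectories on `I` whose uncertainty lies between the given bounds. -/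
structure KnownErrorBound {nx nu nz : ℕ} (sys : Plant nx nu nz) (obs : ObserverParams nx nz)
    (I : Set ℝ) (pLow pHigh ε η θ : ℝ) : Prop where
  ε_pos : 0 < ε
  η_pos : 0 < η
  θ_gt : obs.κ / 2 < θ
  bound : ∀ u x xh P, IsTrajectory sys obs I u x xh P → UncertaintyBounds I pLow pHigh P →
    ‖x 0 - xh 0‖ < ε → ∀ t ∈ I, ‖x t - xh t‖ ≤ η * ‖x 0 - xh 0‖ * Real.exp (-θ * t)

/-- The Lie derivative `L_f h (x) = ∇h(x)ᵀ f(x)`. -/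
noncomputable def lieF {nx nu nz : ℕ} (sys : Plant nx nu nz) (h : E nx → ℝ) (x : E nx) : ℝ :=
  fderiv ℝ h x (sys.f x)

/-- The Lie derivative `L_g h (x) = ∇h(x)ᵀ g(x)`, as a linear functional of the control. -/
noncomputable def lieG {nx nu nz : ℕ} (sys : Plant nx nu nz) (h : E nx → ℝ) (x : E nx) :
    E nu →ₗ[ℝ] ℝ :=
  (fderiv ℝ h x).toLinearMap ∘ₗ Matrix.toEuclideanLin (sys.g x)

/-- The safe set `{x ∈ X : h x ≥ 0}`. -/
def safeSet {nx nu nz : ℕ} (sys : Plant nx nu nz) (h : E nx → ℝ) : Set (E nx) :=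
  {x ∈ sys.X | 0 ≤ h x}

/-- `h` is an observer-based control barrier function, with constant `α`, where `M0` is the value at
time `0` of the error bound, `θ` its rate, `rLow • I ≤ R`, `pHigh` the upper bound of the
uncertainty, and `Kh`, `Kq` are Lipschitz constants of `h` and `q`. -/
structure IsCBF {nx nu nz : ℕ} (sys : Plant nx nu nz) (h : E nx → ℝ)
    (α θ M0 pHigh rLow : ℝ) (Kh Kq : ℝ≥0) : Prop where
  smooth : ∀ x ∈ sys.X ∪ sys.Xhat, ContDiffAt ℝ 2 h x
  interior_nonempty : (interior (safeSet sys h)).Nonempty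
  α_pos : 0 < α
  α_le : α ≤ θ
  sup_ge : ∀ x ∈ safeSet sys h,
    -α * h x ≤ sSup ((fun u : E nu =>
      lieF sys h x + lieG sys h x u - rLow⁻¹ * pHigh * Kh * (Kq : ℝ) ^ 2 * M0) '' sys.U)

/-- The set of controls `u ∈ ℝ^nu` that satisfy the barrier constraint at uncertainty `P`, estimate
`xh` and output `z`. -/
def cbfFeasible {nx nu nz : ℕ} (sys : Plant nx nu nz) (obs : ObserverParams nx nz) (h : E nx → ℝ)
    (α : ℝ) (P : Matrix (Fin nx) (Fin nx) ℝ) (xh : E nx) (z : E nz) : Set (E nu) :=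
  {u | 0 ≤ lieF sys h xh + lieG sys h xh u + α * h xh + fderiv ℝ h xh (injection sys obs P xh z)}

/-- The objective `‖u - πn xh‖² - c₁ λ_min (S(t + Δt))`, with `S = P⁻¹`. -/
noncomputable def objective {nx nu nz : ℕ} (sys : Plant nx nu nz) (obs : ObserverParams nx nz)
    (πn : E nx → E nu) (c₁ Δt : ℝ) (P : Matrix (Fin nx) (Fin nx) ℝ) (xh : E nx) (u : E nu) : ℝ :=
  ‖u - πn xh‖ ^ 2 - c₁ * lambdaMin (nextS sys obs Δt P⁻¹ xh u)

/-- `u` is a minimizer of the confidence-aware program at uncertainty `P`, estimate `xh` and output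
`z`. -/
def IsMinimizer {nx nu nz : ℕ} (sys : Plant nx nu nz) (obs : ObserverParams nx nz) (h : E nx → ℝ)
    (α : ℝ) (πn : E nx → E nu) (c₁ Δt : ℝ) (P : Matrix (Fin nx) (Fin nx) ℝ) (xh : E nx)
    (z : E nz) (u : E nu) : Prop :=
  u ∈ cbfFeasible sys obs h α P xh z ∧
    ∀ v ∈ cbfFeasible sys obs h α P xh z,
      objective sys obs πn c₁ Δt P xh u ≤ objective sys obs πn c₁ Δt P xh v

/-- The controller `π` renders the plant safe from the initial state `x₀` and initial estimate
`xh₀`: along every closed-loop trajectory, `x` stays in the safe set. -/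
def RendersSafe {nx nu nz : ℕ} (sys : Plant nx nu nz) (obs : ObserverParams nx nz) (I : Set ℝ)
    (P : ℝ → Matrix (Fin nx) (Fin nx) ℝ) (h : E nx → ℝ) (x₀ xh₀ : E nx)
    (π : ℝ → E nx → E nz → E nu) : Prop :=
  ∀ x xh : ℝ → E nx,
    IsTrajectory sys obs I (fun t => π t (xh t) (sys.q (x t))) x xh P →
    x 0 = x₀ → xh 0 = xh₀ → ∀ t ∈ I, x t ∈ safeSet sys h

end ConfidenceCBF

open ConfidenceCBF

/-!
At fixed uncertainty `P`, estimate `xh` and output `z`, the program minimizes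
`‖u - m‖² - c λ_min (T₀ + T₁ u)` over a half-space `0 ≤ b + ⟪a, u⟫`.  Since `λ_min` is concave on
symmetric operators, the objective is strongly convex, and relative degree one means `a ≠ 0`, so the
half-space is not empty.  This gives existence and uniqueness, and, by a closed-graph argument with
local bounds, continuous dependence of the minimizer on the data `(m, T₀, T₁, a, b)`
(`ProgramData.tendsto_isSol`).  The data depend continuously on `P` and any one-sided limit of `P` is
still positive definite, whence piecewise continuity in time.

Lipschitz dependence needs the simple lowest eigenvalue.  If the lowest eigenvalue of a symmetric `S`
has a gap `g`, the projections to the lowest eigenvectors of `S` and of any symmetric `T` differ by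
`O(‖S - T‖ / g)` (`HasGap.abs_inner_sub_inner_le`).  So the objective is differentiable at the
minimizer, its gradient is Lipschitz in the data and the control there, and the
Karush-Kuhn-Tucker conditions hold (`ProgramData.IsSol.exists_multiplier`).  Comparing these
conditions for two sets of data, with strong convexity on one side and complementary slackness on the
other, yields `‖u₁ - u₂‖² ≤ C δ ‖u₁ - u₂‖ + C δ²` with `δ` the distance of the data, hence a Lipschitz
bound (`ProgramData.exists_lipschitz_const`).  By compactness its constants, the gap included, are
uniform over compact sets of data (`ProgramData.exists_lipschitzOnWith`).  Finally, the data are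
locally Lipschitz in `(P, P⁻¹, xh, z)`, because `f`, `g`, `q` and `h` are `C²`.

For safety, the constraint says that `exp (α t) h (xh t)` has nonnegative derivative, except at times
from a locally finite set, so `h (xh t) ≥ h (xh 0) exp (-α t)`.  The state differs from the estimate
by at most `M₀ exp (-θ t)` with `θ ≥ α`, and `h (x₀) ≥ 2 K_h M₀` gives `h (xh 0) ≥ K_h M₀`;
the Lipschitz bound on `h` then yields `h (x t) ≥ 0` (`IsTrajectory.mem_safeSet`).
-/

namespace ConfidenceCBF

/-! ### The smallest value of the Rayleigh quotient -/

section Rayleigh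

open scoped InnerProductSpace

variable {X : Type*} [NormedAddCommGroup X] [InnerProductSpace ℝ X]

/-- The minimum of `⟪x, T x⟫` over the unit sphere, which is the smallest eigenvalue if `T` is
symmetric and the space is finite-dimensional and nontrivial. -/
noncomputable def minRayleigh (T : X →L[ℝ] X) : ℝ :=
  sInf ((fun x => ⟪x, T x⟫_ℝ) '' Metric.sphere 0 1)

/-- `v` is a unit vector at which `⟪v, T v⟫` is minimal on the unit sphere, that is, a unit
eigenvector for the smallest eigenvalue if `T` is symmetric. -/
def IsBottom (T : X →L[ℝ] X) (v : X) : Prop :=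
  ‖v‖ = 1 ∧ ⟪v, T v⟫_ℝ = minRayleigh T

/-- The smallest eigenvalue of the symmetric operator `T` is separated by at least `g` from the
values of the quadratic form of `T` on the unit vectors orthogonal to a lowest eigenvector. -/
def HasGap (T : X →L[ℝ] X) (g : ℝ) : Prop :=
  ∀ v y, IsBottom T v → ‖y‖ = 1 → ⟪v, y⟫_ℝ = 0 → minRayleigh T + g ≤ ⟪y, T y⟫_ℝ

theorem abs_inner_apply_le (T : X →L[ℝ] X) (x y : X) : |⟪x, T y⟫_ℝ| ≤ ‖T‖ * ‖x‖ * ‖y‖ := by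
  calc |⟪x, T y⟫_ℝ| ≤ ‖x‖ * ‖T y‖ := abs_real_inner_le_norm _ _
    _ ≤ ‖x‖ * (‖T‖ * ‖y‖) := by gcongr; exact T.le_opNorm y
    _ = ‖T‖ * ‖x‖ * ‖y‖ := by ring

theorem abs_inner_apply_self_le (T : X →L[ℝ] X) {x : X} (hx : ‖x‖ = 1) : |⟪x, T x⟫_ℝ| ≤ ‖T‖ := by
  simpa [hx] using abs_inner_apply_le T x x

theorem bddBelow_inner_sphere (T : X →L[ℝ] X) :
    BddBelow ((fun x => ⟪x, T x⟫_ℝ) '' Metric.sphere 0 1) := by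
  refine ⟨-‖T‖, ?_⟩
  rintro _ ⟨x, hx, rfl⟩
  exact (abs_le.1 (abs_inner_apply_self_le T (by simpa using hx))).1

theorem minRayleigh_le (T : X →L[ℝ] X) {x : X} (hx : ‖x‖ = 1) : minRayleigh T ≤ ⟪x, T x⟫_ℝ :=
  csInf_le (bddBelow_inner_sphere T) ⟨x, by simpa using hx, rfl⟩

theorem scaled_le_inner_of_unit {T : X →L[ℝ] X} {m : ℝ} {x : X}
    (h : ∀ r : ℝ, ‖r • x‖ = 1 → m ≤ ⟪r • x, T (r • x)⟫_ℝ) : m * ‖x‖ ^ 2 ≤ ⟪x, T x⟫_ℝ := by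
  rcases eq_or_ne x 0 with rfl | hx
  · simp
  have hx' : 0 < ‖x‖ := norm_pos_iff.2 hx
  have h1 := h ‖x‖⁻¹ (by rw [norm_smul, norm_inv, norm_norm, inv_mul_cancel₀ hx'.ne'])
  rw [map_smul, real_inner_smul_left, real_inner_smul_right, ← mul_assoc, ← mul_inv, ← pow_two,
    inv_mul_eq_div, le_div_iff₀ (by positivity)] at h1
  exact h1

theorem minRayleigh_mul_sq_le (T : X →L[ℝ] X) (x : X) :
    minRayleigh T * ‖x‖ ^ 2 ≤ ⟪x, T x⟫_ℝ :=
  scaled_le_inner_of_unit fun _ hr => minRayleigh_le T hr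

theorem HasGap.mul_sq_le {T : X →L[ℝ] X} {g : ℝ} (hg : HasGap T g) {v w : X} (hv : IsBottom T v)
    (hw : ⟪v, w⟫_ℝ = 0) : (minRayleigh T + g) * ‖w‖ ^ 2 ≤ ⟪w, T w⟫_ℝ :=
  scaled_le_inner_of_unit fun r hr => hg v _ hv hr (by rw [real_inner_smul_right, hw, mul_zero])

/-- A minimizer of the Rayleigh quotient is an eigenvector: the quadratic form of `T - λ` is
nonnegative and vanishes at `v`, hence its polarization at `v` vanishes too. -/
theorem IsBottom.apply_eq {T : X →L[ℝ] X} (hT : T.IsSymmetric) {v : X} (hv : IsBottom T v) :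
    T v = minRayleigh T • v := by
  set m := minRayleigh T
  set w := T v - m • v with hw
  suffices h : ⟪w, w⟫_ℝ = 0 from sub_eq_zero.1 (inner_self_eq_zero.1 h)
  have hsym : ⟪w, T v⟫_ℝ = ⟪v, T w⟫_ℝ := by rw [real_inner_comm]; exact hT v w
  have hvv : ⟪v, v⟫_ℝ = 1 := by rw [real_inner_self_eq_norm_sq, hv.1]; norm_num
  have hww : ⟪w, w⟫_ℝ = ⟪w, T v⟫_ℝ - m * ⟪v, w⟫_ℝ := by
    conv_lhs => rw [hw]
    rw [← hw, inner_sub_left, real_inner_smul_left, real_inner_comm]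
  have key : ∀ s : ℝ, 0 ≤ 2 * s * ⟪w, w⟫_ℝ + s ^ 2 * (⟪w, T w⟫_ℝ - m * ⟪w, w⟫_ℝ) := by
    intro s
    have h1 := minRayleigh_mul_sq_le T (v + s • w)
    rw [← real_inner_self_eq_norm_sq] at h1
    simp only [map_add, map_smul, inner_add_left, inner_add_right, real_inner_smul_left,
      real_inner_smul_right, real_inner_comm v w, hvv] at h1
    have h2 := hv.2
    rw [← hsym] at h1
    have e : 2 * s * ⟪w, w⟫_ℝ = 2 * s * (⟪w, T v⟫_ℝ - m * ⟪v, w⟫_ℝ) := by rw [← hww]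
    linarith
  by_contra hne
  have hpos : 0 < ⟪w, w⟫_ℝ := lt_of_le_of_ne real_inner_self_nonneg (Ne.symm hne)
  have h0 := key (-1 / (1 + |⟪w, T w⟫_ℝ - m * ⟪w, w⟫_ℝ| / ⟪w, w⟫_ℝ))
  set a := ⟪w, w⟫_ℝ
  set b := ⟪w, T w⟫_ℝ - m * a
  have hden : 0 < 1 + |b| / a := by positivity
  set t := 1 / (1 + |b| / a) with ht
  have ht0 : 0 < t := by positivity
  have hta : t * (a + |b|) = a := by
    rw [ht]; field_simp
  have : -1 / (1 + |b| / a) = -t := by rw [ht]; ring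
  rw [this] at h0
  have hb := le_abs_self b
  nlinarith [mul_pos ht0 hpos, mul_pos ht0 ht0, mul_le_mul_of_nonneg_left hb (sq_nonneg t)]

theorem continuous_inner_apply_self (T : X →L[ℝ] X) : Continuous fun x => ⟪x, T x⟫_ℝ := by
  fun_prop

theorem exists_isBottom [FiniteDimensional ℝ X] [Nontrivial X] (T : X →L[ℝ] X) :
    ∃ v, IsBottom T v := by
  have : ProperSpace X := FiniteDimensional.proper_real X
  obtain ⟨v, hv, hmin⟩ := (isCompact_sphere (0 : X) 1).exists_sInf_image_eq
    (NormedSpace.sphere_nonempty.2 zero_le_one) (continuous_inner_apply_self T).continuousOn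
  exact ⟨v, by simpa using hv, hmin.symm⟩

theorem minRayleigh_le_add_norm_sub [FiniteDimensional ℝ X] [Nontrivial X] (S T : X →L[ℝ] X) :
    minRayleigh S ≤ minRayleigh T + ‖S - T‖ := by
  obtain ⟨v, hv⟩ := exists_isBottom T
  have h1 := minRayleigh_le S hv.1
  have h2 := (abs_le.1 (abs_inner_apply_self_le (S - T) hv.1)).2
  rw [sub_apply, inner_sub_right, hv.2] at h2
  linarith

theorem continuous_minRayleigh [FiniteDimensional ℝ X] [Nontrivial X] :
    Continuous (minRayleigh : (X →L[ℝ] X) → ℝ) := by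
  refine (LipschitzWith.of_le_add fun S T => ?_).continuous
  rw [dist_eq_norm]
  exact minRayleigh_le_add_norm_sub S T

theorem minRayleigh_le_norm [FiniteDimensional ℝ X] [Nontrivial X] (T : X →L[ℝ] X) :
    minRayleigh T ≤ ‖T‖ := by
  obtain ⟨v, hv⟩ := exists_isBottom T
  exact hv.2 ▸ (abs_le.1 (abs_inner_apply_self_le T hv.1)).2

/-- If the smallest eigenvalue of `S` is isolated by a gap `g`, the projections to the lowest
eigenvectors of `S` and of any symmetric `T` differ by `O(‖S - T‖ / g)`; here the difference is
tested against an operator `B`.  No smallness of `‖S - T‖` and no gap of `T` is needed: the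
component `w` of the lowest eigenvector of `T` orthogonal to that of `S` satisfies
`g ‖w‖ ≤ 2 ‖S - T‖`. -/
theorem HasGap.abs_inner_sub_inner_le [FiniteDimensional ℝ X] [Nontrivial X] {S T : X →L[ℝ] X}
    (hS : S.IsSymmetric) (hT : T.IsSymmetric) {g : ℝ} (hg : 0 < g) (hgap : HasGap S g) {v v' : X}
    (hv : IsBottom S v) (hv' : IsBottom T v') (B : X →L[ℝ] X) :
    |⟪v', B v'⟫_ℝ - ⟪v, B v⟫_ℝ| ≤ 8 / g * ‖S - T‖ * ‖B‖ := by
  set c := ⟪v, v'⟫_ℝ with hc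
  set w := v' - c • v with hw
  have hvv : ⟪v, v⟫_ℝ = 1 := by rw [real_inner_self_eq_norm_sq, hv.1]; norm_num
  have hvv' : ⟪v', v'⟫_ℝ = 1 := by rw [real_inner_self_eq_norm_sq, hv'.1]; norm_num
  have hvw : ⟪v, w⟫_ℝ = 0 := by
    rw [hw, inner_sub_right, real_inner_smul_right, hvv, ← hc]; ring
  have hwv : ⟪w, v⟫_ℝ = 0 := by rw [real_inner_comm]; exact hvw
  have hdec : v' = c • v + w := by rw [hw]; abel
  have hwv' : ⟪w, v'⟫_ℝ = ‖w‖ ^ 2 := by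
    rw [hdec, inner_add_right, real_inner_smul_right, hwv, real_inner_self_eq_norm_sq]; ring
  have hsum : c ^ 2 + ‖w‖ ^ 2 = 1 := by
    rw [← hvv', ← hwv', hw, inner_sub_left, real_inner_smul_left, ← hc]; ring
  have hw1 : ‖w‖ ≤ 1 := by nlinarith [norm_nonneg w, sq_nonneg c]
  have hc1 : |c| ≤ 1 := by
    rw [← sq_le_one_iff_abs_le_one]; nlinarith [sq_nonneg ‖w‖]
  have hgw : g * ‖w‖ ≤ 2 * ‖S - T‖ := by
    have h1 := hgap.mul_sq_le hv hvw
    have h2 : ⟪w, S w⟫_ℝ = ⟪w, S v'⟫_ℝ := by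
      conv_rhs => rw [hdec]
      rw [map_add, map_smul, hv.apply_eq hS, inner_add_right, real_inner_smul_right,
        real_inner_smul_right, hwv]; ring
    have h3 : ⟪w, S v'⟫_ℝ = minRayleigh T * ‖w‖ ^ 2 + ⟪w, (S - T) v'⟫_ℝ := by
      rw [sub_apply, inner_sub_right, hv'.apply_eq hT, real_inner_smul_right,
        hwv']; ring
    have h4 := (abs_le.1 (abs_inner_apply_le (S - T) w v')).2
    rw [hv'.1, mul_one] at h4
    have h5 := minRayleigh_le_add_norm_sub T S
    rw [norm_sub_rev] at h5
    rcases (norm_nonneg w).eq_or_lt with h0 | h0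
    · rw [← h0, mul_zero]; positivity
    · refine le_of_mul_le_mul_right ?_ h0
      have h6 : ‖S - T‖ * ‖w‖ ^ 2 ≤ ‖S - T‖ * ‖w‖ := by
        rw [pow_two]
        exact mul_le_mul_of_nonneg_left (mul_le_of_le_one_left h0.le hw1) (norm_nonneg _)
      nlinarith [mul_le_mul_of_nonneg_right h5 (sq_nonneg ‖w‖)]
  have hexp : ⟪v', B v'⟫_ℝ - ⟪v, B v⟫_ℝ =
      -‖w‖ ^ 2 * ⟪v, B v⟫_ℝ + (c * ⟪w, B v⟫_ℝ + c * ⟪v, B w⟫_ℝ) + ⟪w, B w⟫_ℝ := by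
    conv_lhs => rw [hdec]
    simp only [map_add, map_smul, inner_add_left, inner_add_right, real_inner_smul_left,
      real_inner_smul_right]
    linear_combination ⟪v, B v⟫_ℝ * hsum
  have hB0 := norm_nonneg B
  have e1 : |-‖w‖ ^ 2 * ⟪v, B v⟫_ℝ| ≤ ‖B‖ * ‖w‖ := by
    rw [abs_mul, abs_neg, abs_of_nonneg (sq_nonneg ‖w‖), mul_comm]
    exact mul_le_mul (abs_inner_apply_self_le B hv.1)
      (by rw [pow_two]; exact mul_le_of_le_one_left (norm_nonneg w) hw1) (by positivity) hB0
  have e2 : |c * ⟪w, B v⟫_ℝ| ≤ ‖B‖ * ‖w‖ := by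
    rw [abs_mul]
    have := abs_inner_apply_le B w v
    rw [hv.1, mul_one] at this
    exact (mul_le_of_le_one_left (abs_nonneg _) hc1).trans this
  have e3 : |c * ⟪v, B w⟫_ℝ| ≤ ‖B‖ * ‖w‖ := by
    rw [abs_mul]
    have := abs_inner_apply_le B v w
    rw [hv.1, mul_one] at this
    exact (mul_le_of_le_one_left (abs_nonneg _) hc1).trans this
  have e4 : |⟪w, B w⟫_ℝ| ≤ ‖B‖ * ‖w‖ :=
    (abs_inner_apply_le B w w).trans (mul_le_of_le_one_right (by positivity) hw1)
  have e5 : |⟪v', B v'⟫_ℝ - ⟪v, B v⟫_ℝ| ≤ 4 * (‖B‖ * ‖w‖) := by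
    rw [hexp]
    refine (abs_add_three _ _ _).trans ?_
    linarith [abs_add_le (c * ⟪w, B v⟫_ℝ) (c * ⟪v, B w⟫_ℝ)]
  have hw2 : ‖w‖ ≤ 2 * ‖S - T‖ / g := by rw [le_div_iff₀ hg]; linarith
  calc _ ≤ 4 * (‖B‖ * ‖w‖) := e5
    _ ≤ 4 * (‖B‖ * (2 * ‖S - T‖ / g)) := by gcongr
    _ = 8 / g * ‖S - T‖ * ‖B‖ := by ring

end Rayleigh

/-! ### The program: existence, uniqueness and continuity -/

section Program

open scoped InnerProductSpace

variable {F X : Type*} [NormedAddCommGroup F] [InnerProductSpace ℝ F]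
  [NormedAddCommGroup X] [InnerProductSpace ℝ X]

variable (F X) in
/-- Data `(m, T₀, T₁, a, b)` of the program: minimize `‖u - m‖² - c λ_min (T₀ + T₁ u)` over the
half-space `0 ≤ b + ⟪a, u⟫`.  The product norm measures the perturbation of the data. -/
abbrev ProgramData := F × (X →L[ℝ] X) × (F →L[ℝ] X →L[ℝ] X) × F × ℝ

namespace ProgramData

/-- The nominal control. -/
abbrev nominal (d : ProgramData F X) : F := d.1

/-- The constant term of the operator pencil. -/
abbrev base (d : ProgramData F X) : X →L[ℝ] X := d.2.1

/-- The linear term of the operator pencil. -/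
abbrev slope (d : ProgramData F X) : F →L[ℝ] X →L[ℝ] X := d.2.2.1

/-- The inner normal vector of the half-space of feasible controls. -/
abbrev normal (d : ProgramData F X) : F := d.2.2.2.1

/-- The constant term of the constraint. -/
abbrev offset (d : ProgramData F X) : ℝ := d.2.2.2.2

/-- The operator `T₀ + T₁ u`. -/
noncomputable def pencil (d : ProgramData F X) (u : F) : X →L[ℝ] X := d.base + d.slope u

/-- The objective of the program. -/
noncomputable def cost (c : ℝ) (d : ProgramData F X) (u : F) : ℝ :=
  ‖u - d.nominal‖ ^ 2 - c * minRayleigh (d.pencil u)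

/-- The affine function whose nonnegativity is the constraint. -/
noncomputable def slack (d : ProgramData F X) (u : F) : ℝ := d.offset + ⟪d.normal, u⟫_ℝ

/-- `u` is feasible and minimizes the cost. -/
def IsSol (c : ℝ) (d : ProgramData F X) (u : F) : Prop :=
  0 ≤ d.slack u ∧ ∀ v, 0 ≤ d.slack v → d.cost c u ≤ d.cost c v

/-- The pencil consists of symmetric operators and the constraint is not degenerate. -/
structure Regular (d : ProgramData F X) : Prop where
  normal_ne : d.normal ≠ 0
  base_symm : d.base.IsSymmetric
  slope_symm : ∀ u, (d.slope u).IsSymmetric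

theorem Regular.pencil_symm {d : ProgramData F X} (hd : d.Regular) (u : F) :
    (d.pencil u).IsSymmetric := by
  have := LinearMap.IsSymmetric.add hd.base_symm (hd.slope_symm u)
  simpa [pencil] using this

theorem slack_add (d : ProgramData F X) (u w : F) :
    d.slack (u + w) = d.slack u + ⟪d.normal, w⟫_ℝ := by
  rw [slack, slack, inner_add_right]; ring

theorem continuous_slack : Continuous fun p : ProgramData F X × F => p.1.slack p.2 := by
  unfold slack; fun_prop

theorem continuous_normal : Continuous fun d : ProgramData F X => d.normal := by fun_prop

theorem continuous_pencil : Continuous fun p : ProgramData F X × F => p.1.pencil p.2 := by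
  unfold pencil; fun_prop

theorem continuous_cost [FiniteDimensional ℝ X] [Nontrivial X] (c : ℝ) :
    Continuous fun p : ProgramData F X × F => p.1.cost c p.2 := by
  unfold cost
  have := continuous_minRayleigh.comp (continuous_pencil (F := F) (X := X))
  exact ((continuous_snd.sub continuous_fst.fst).norm.pow 2).sub (continuous_const.mul this)

/-- The orthogonal projection of the feasible half-space: `u` is moved along the normal just far
enough to satisfy the constraint. -/
noncomputable def repair (d : ProgramData F X) (u : F) : F :=
  u + (max 0 (-d.slack u) / ‖d.normal‖ ^ 2) • d.normal

theorem slack_repair {d : ProgramData F X} (hd : d.normal ≠ 0) (u : F) :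
    0 ≤ d.slack (d.repair u) := by
  have : ‖d.normal‖ ≠ 0 := norm_ne_zero_iff.2 hd
  rw [repair, slack_add, real_inner_smul_right, real_inner_self_eq_norm_sq,
    div_mul_cancel₀ _ (pow_ne_zero 2 this)]
  linarith [le_max_right 0 (-d.slack u)]

theorem repair_eq_self {d : ProgramData F X} {u : F} (hu : 0 ≤ d.slack u) : d.repair u = u := by
  rw [repair, max_eq_left (by linarith), zero_div, zero_smul, add_zero]

theorem continuousAt_repair {d : ProgramData F X} (hd : d.normal ≠ 0) (u : F) :
    ContinuousAt (fun d' : ProgramData F X => d'.repair u) d := by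
  have h1 : ContinuousAt (fun d' : ProgramData F X => max 0 (-d'.slack u)) d :=
    (continuous_const.max
      (continuous_slack.comp (Continuous.prodMk_left u)).neg).continuousAt
  have h2 : ContinuousAt (fun d' : ProgramData F X => d'.normal) d := by fun_prop
  exact continuousAt_const.add ((h1.div (h2.norm.pow 2)
    (pow_ne_zero 2 (norm_ne_zero_iff.2 hd))).smul h2)

/-- The smallest eigenvalue is concave along the pencil; a lowest eigenvector `v` at `u` provides
a supergradient. -/
theorem minRayleigh_pencil_le (d : ProgramData F X) {u : F} {v : X} (hv : IsBottom (d.pencil u) v)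
    (u' : F) :
    minRayleigh (d.pencil u') ≤ minRayleigh (d.pencil u) + ⟪v, d.slope (u' - u) v⟫_ℝ := by
  have h1 := minRayleigh_le (d.pencil u') hv.1
  rw [← hv.2]
  simp only [pencil, add_apply, inner_add_right, map_sub, sub_apply, inner_sub_right] at h1 ⊢
  linarith

variable [FiniteDimensional ℝ X] [Nontrivial X]

theorem cost_midpoint_le {c : ℝ} (hc : 0 ≤ c) (d : ProgramData F X) (u u' : F) :
    d.cost c ((1 / 2 : ℝ) • (u + u')) ≤
      (d.cost c u + d.cost c u') / 2 - ‖u - u'‖ ^ 2 / 4 := by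
  set w := (1 / 2 : ℝ) • (u + u') with hw
  obtain ⟨v, hv⟩ := exists_isBottom (d.pencil w)
  have h1 := d.minRayleigh_pencil_le hv u
  have h2 := d.minRayleigh_pencil_le hv u'
  have h3 : d.slope (u - w) + d.slope (u' - w) = 0 := by
    rw [← map_add, show u - w + (u' - w) = 0 by rw [hw]; module, map_zero]
  have h4 : ⟪v, d.slope (u - w) v⟫_ℝ + ⟪v, d.slope (u' - w) v⟫_ℝ = 0 := by
    rw [← inner_add_right, ← add_apply, h3]; simp
  have h5 := parallelogram_law_with_norm ℝ (u - d.nominal) (u' - d.nominal)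
  rw [show u - d.nominal - (u' - d.nominal) = u - u' by abel,
    show u - d.nominal + (u' - d.nominal) = (2 : ℝ) • (w - d.nominal) by rw [hw]; module,
    norm_smul, Real.norm_ofNat] at h5
  unfold cost
  nlinarith

theorem IsSol.eq {c : ℝ} (hc : 0 ≤ c) {d : ProgramData F X} {u u' : F} (hu : d.IsSol c u)
    (hu' : d.IsSol c u') : u = u' := by
  have hs : 0 ≤ d.slack ((1 / 2 : ℝ) • (u + u')) := by
    have h1 := hu.1
    have h2 := hu'.1
    simp only [slack, inner_smul_right, inner_add_right] at h1 h2 ⊢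
    linarith
  have h1 := hu.2 _ hs
  have h2 := hu'.2 _ hu.1
  have h3 := d.cost_midpoint_le hc u u'
  have h4 : ‖u - u'‖ ^ 2 = 0 := le_antisymm (by linarith) (by positivity)
  exact sub_eq_zero.1 (norm_eq_zero.1 (pow_eq_zero_iff two_ne_zero |>.1 h4))

/-- The cost grows quadratically, uniformly for bounded data. -/
theorem le_cost {c B : ℝ} (hc : 0 ≤ c) (d : ProgramData F X) (hd : ‖d‖ ≤ B) (u : F) :
    ‖u‖ ^ 2 / 2 - ((2 * B + c * B) ^ 2 / 2 + c * B) ≤ d.cost c u := by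
  have hm : ‖d.nominal‖ ≤ B := (norm_fst_le d).trans hd
  have hb : ‖d.base‖ ≤ B := ((norm_fst_le d.2).trans (norm_snd_le d)).trans hd
  have hs : ‖d.slope‖ ≤ B :=
    ((norm_fst_le d.2.2).trans ((norm_snd_le d.2).trans (norm_snd_le d))).trans hd
  have h1 : minRayleigh (d.pencil u) ≤ B + B * ‖u‖ :=
    (minRayleigh_le_norm _).trans ((norm_add_le _ _).trans
      (add_le_add hb ((d.slope.le_opNorm u).trans (by gcongr))))
  have h2 : ‖u‖ - B ≤ ‖u - d.nominal‖ := by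
    linarith [norm_sub_norm_le u d.nominal]
  have h3 : ‖u‖ ^ 2 - 2 * B * ‖u‖ ≤ ‖u - d.nominal‖ ^ 2 := by
    have := norm_sub_sq_real u d.nominal
    have h4 := real_inner_le_norm u d.nominal
    nlinarith [mul_le_mul_of_nonneg_left hm (norm_nonneg u), sq_nonneg ‖d.nominal‖]
  have h5 := mul_le_mul_of_nonneg_left h1 hc
  unfold cost
  nlinarith [sq_nonneg (‖u‖ - (2 * B + c * B))]

theorem exists_isSol [FiniteDimensional ℝ F] {c : ℝ} (hc : 0 ≤ c) {d : ProgramData F X}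
    (hd : d.normal ≠ 0) : ∃ u, d.IsSol c u := by
  have hcont : Continuous (d.cost c) := (continuous_cost c).comp (Continuous.prodMk_right d)
  have hclosed : IsClosed {u | 0 ≤ d.slack u} :=
    isClosed_le continuous_const (continuous_slack.comp (Continuous.prodMk_right d))
  have hlim : Tendsto (d.cost c) (cocompact F) atTop := by
    refine tendsto_atTop_mono (d.le_cost hc le_rfl) (tendsto_atTop_add_const_right _ _ ?_)
    exact ((tendsto_pow_atTop two_ne_zero).comp (tendsto_norm_cocompact_atTop)).atTop_div_const
      two_pos
  obtain ⟨u, hu, hmin⟩ := hcont.continuousOn.exists_isMinOn' hclosed (d.slack_repair hd 0)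
    ((hlim.eventually_ge_atTop _).filter_mono inf_le_left)
  exact ⟨u, hu, fun v hv => hmin hv⟩

/-- A limit of solutions is a solution for the limit data: a competitor for the limit data becomes
one for the nearby data after a small repair. -/
theorem isSol_of_tendsto {ι : Type*} {l : Filter ι} [l.NeBot] {c : ℝ} {δ : ι → ProgramData F X}
    {d : ProgramData F X} (hd : d.normal ≠ 0) (hδ : Tendsto δ l (𝓝 d)) {υ : ι → F} {u : F}
    (hυ : Tendsto υ l (𝓝 u)) (hsol : ∀ᶠ i in l, (δ i).IsSol c (υ i)) : d.IsSol c u := by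
  have hpair := hδ.prodMk_nhds hυ
  refine ⟨ge_of_tendsto ((continuous_slack.tendsto _).comp hpair) (hsol.mono fun i hi => hi.1),
    fun v hv => ?_⟩
  have h1 : Tendsto (fun i => (δ i).repair v) l (𝓝 v) := by
    have := (continuousAt_repair hd v).tendsto.comp hδ
    rwa [repair_eq_self hv] at this
  have h2 : ∀ᶠ i in l, (δ i).normal ≠ 0 :=
    hδ.eventually (continuous_normal.continuousAt.eventually_ne hd)
  refine le_of_tendsto_of_tendsto (((continuous_cost c).tendsto _).comp hpair)
    (((continuous_cost c).tendsto _).comp (hδ.prodMk_nhds h1)) ?_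
  filter_upwards [hsol, h2] with i hi hi2
  exact hi.2 _ (slack_repair hi2 v)

/-- The solution depends continuously on the data. -/
theorem tendsto_isSol [FiniteDimensional ℝ F] {ι : Type*} {l : Filter ι} {c : ℝ} (hc : 0 ≤ c)
    {δ : ι → ProgramData F X}
    {d : ProgramData F X} (hd : d.normal ≠ 0) (hδ : Tendsto δ l (𝓝 d)) {υ : ι → F} {u : F}
    (hsol : ∀ᶠ i in l, (δ i).IsSol c (υ i)) (hu : d.IsSol c u) : Tendsto υ l (𝓝 u) := by
  have : ProperSpace F := FiniteDimensional.proper_real F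
  set B := ‖d‖ + 1
  set K := (2 * B + c * B) ^ 2 / 2 + c * B
  set M := d.cost c (d.repair 0) + 1
  have h1 : ∀ᶠ i in l, ‖δ i‖ < B :=
    ((continuous_norm.tendsto d).comp hδ).eventually_lt_const (lt_add_one _)
  have h2 : ∀ᶠ i in l, (δ i).normal ≠ 0 :=
    hδ.eventually (continuous_normal.continuousAt.eventually_ne hd)
  have h3 : ∀ᶠ i in l, (δ i).cost c ((δ i).repair 0) < M :=
    (((continuous_cost c).tendsto _).comp
      (hδ.prodMk_nhds ((continuousAt_repair hd 0).tendsto.comp hδ))).eventually_lt_const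
        (lt_add_one _)
  refine (isCompact_closedBall (0 : F) (1 + 2 * (M + K))).tendsto_nhds_of_unique_mapClusterPt ?_ ?_
  · filter_upwards [h1, h2, h3, hsol] with i hi1 hi2 hi3 hi
    have h4 : ‖υ i‖ ^ 2 / 2 - K ≤ (δ i).cost c (υ i) := (δ i).le_cost hc hi1.le (υ i)
    have h5 := hi.2 _ (slack_repair hi2 0)
    rw [mem_closedBall_zero_iff]
    nlinarith [sq_nonneg (‖υ i‖ - 1), sq_nonneg ‖υ i‖]
  · intro y _ hy
    obtain ⟨U, hU, hUy⟩ := mapClusterPt_iff_ultrafilter.1 hy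
    exact (isSol_of_tendsto hd (hδ.mono_left hU) hUy (hsol.filter_mono hU)).eq hc hu

end ProgramData

end Program

/-! ### The program: first-order condition and Lipschitz dependence on the data -/

section Lipschitz

open scoped InnerProductSpace

variable {F X : Type*} [NormedAddCommGroup F] [InnerProductSpace ℝ F]
  [NormedAddCommGroup X] [InnerProductSpace ℝ X]

namespace ProgramData

/-- The derivative of the cost at `u` in the direction `w`, if `v` is a lowest eigenvector of the
pencil at `u` and the lowest eigenvalue is simple.  In general this is the value of a subgradient. -/
noncomputable def gradCost (c : ℝ) (d : ProgramData F X) (u : F) (v : X) (w : F) : ℝ :=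
  2 * ⟪u - d.nominal, w⟫_ℝ - c * ⟪v, d.slope w v⟫_ℝ

theorem norm_slope_le (d : ProgramData F X) : ‖d.slope‖ ≤ ‖d‖ :=
  (norm_fst_le d.2.2).trans ((norm_snd_le d.2).trans (norm_snd_le d))

theorem le_mul_of_sq_le {D N δ : ℝ} (hδ : 0 ≤ δ) (hD : 0 ≤ D)
    (h : D ^ 2 ≤ N * δ * D + N * δ ^ 2) : D ≤ (N + 1) * δ := by
  by_contra! hlt
  have h1 : (N + 1) * δ * D ≤ D ^ 2 := by
    rw [pow_two]; exact mul_le_mul_of_nonneg_right hlt.le hD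
  have h2 : N * δ * δ ≤ δ * D := by
    have h3 : N * δ ≤ D := by linarith
    rw [mul_comm δ D]; exact mul_le_mul_of_nonneg_right h3 hδ
  rcases hδ.eq_or_lt with rfl | hδ'
  · nlinarith
  · nlinarith [mul_pos hδ' hδ', mul_lt_mul_of_pos_left hlt hδ']

theorem norm_nominal_sub_le (d d' : ProgramData F X) : ‖d.nominal - d'.nominal‖ ≤ ‖d - d'‖ :=
  norm_fst_le (d - d')

theorem norm_base_sub_le (d d' : ProgramData F X) : ‖d.base - d'.base‖ ≤ ‖d - d'‖ :=
  (norm_fst_le (d - d').2).trans (norm_snd_le (d - d'))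

theorem norm_slope_sub_le (d d' : ProgramData F X) : ‖d.slope - d'.slope‖ ≤ ‖d - d'‖ :=
  (norm_fst_le (d - d').2.2).trans ((norm_snd_le (d - d').2).trans (norm_snd_le (d - d')))

theorem norm_normal_sub_le (d d' : ProgramData F X) : ‖d.normal - d'.normal‖ ≤ ‖d - d'‖ :=
  (norm_fst_le (d - d').2.2.2).trans ((norm_snd_le (d - d').2.2).trans
    ((norm_snd_le (d - d').2).trans (norm_snd_le (d - d'))))

theorem abs_offset_sub_le (d d' : ProgramData F X) : |d.offset - d'.offset| ≤ ‖d - d'‖ :=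
  (norm_snd_le (d - d').2.2.2).trans ((norm_snd_le (d - d').2.2).trans
    ((norm_snd_le (d - d').2).trans (norm_snd_le (d - d'))))

theorem norm_pencil_sub_le {B : ℝ} {d₁ d₂ : ProgramData F X} (h₁ : ‖d₁‖ ≤ B) (u : F) {u₂ : F}
    (hu₂ : ‖u₂‖ ≤ B) :
    ‖d₂.pencil u₂ - d₁.pencil u‖ ≤ (1 + B) * ‖d₁ - d₂‖ + B * ‖u - u₂‖ := by
  have e : d₂.pencil u₂ - d₁.pencil u =
      (d₂.base - d₁.base) + (d₂.slope - d₁.slope) u₂ + d₁.slope (u₂ - u) := by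
    simp only [pencil, sub_apply, map_sub]; abel
  have h2 : ‖d₂.base - d₁.base‖ ≤ ‖d₁ - d₂‖ := by
    rw [norm_sub_rev]; exact norm_base_sub_le _ _
  have h3 : ‖(d₂.slope - d₁.slope) u₂‖ ≤ ‖d₁ - d₂‖ * B := by
    refine ((d₂.slope - d₁.slope).le_opNorm u₂).trans ?_
    rw [norm_sub_rev]
    exact mul_le_mul (norm_slope_sub_le _ _) hu₂ (norm_nonneg _) (norm_nonneg (d₁ - d₂))
  have h4 : ‖d₁.slope (u₂ - u)‖ ≤ B * ‖u - u₂‖ := by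
    refine (d₁.slope.le_opNorm _).trans ?_
    rw [norm_sub_rev]
    gcongr
    exact (norm_slope_le d₁).trans h₁
  rw [e]
  refine (norm_add₃_le).trans ?_
  linarith

theorem gradCost_le {c B : ℝ} (hc : 0 ≤ c) {d : ProgramData F X} (hd : ‖d‖ ≤ B) {u : F}
    (hu : ‖u‖ ≤ B) {v : X} (hv : ‖v‖ = 1) (w : F) :
    d.gradCost c u v w ≤ (4 * B + c * B) * ‖w‖ := by
  have h1 := (abs_le.1 (abs_real_inner_le_norm (u - d.nominal) w)).2
  have h2 := (abs_le.1 (abs_inner_apply_self_le (d.slope w) hv)).1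
  have h3 : ‖d.slope w‖ ≤ B * ‖w‖ :=
    (d.slope.le_opNorm _).trans
      (mul_le_mul_of_nonneg_right ((norm_slope_le d).trans hd) (norm_nonneg w))
  have h4 : ‖u - d.nominal‖ ≤ 2 * B := by
    refine (norm_sub_le _ _).trans ?_
    linarith [(norm_fst_le d).trans hd]
  have h5 := mul_le_mul_of_nonneg_right h4 (norm_nonneg w)
  have h6 : c * -⟪v, d.slope w v⟫_ℝ ≤ c * (B * ‖w‖) :=
    mul_le_mul_of_nonneg_left (by linarith) hc
  simp only [gradCost]
  linarith

variable [FiniteDimensional ℝ X] [Nontrivial X]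

/-- The variational inequality.  The gap makes the lowest eigenvector, hence the derivative of the
cost, Lipschitz along the segment from `u` to a feasible point. -/
theorem IsSol.gradCost_nonneg {c : ℝ} (hc : 0 ≤ c) {d : ProgramData F X} (hd : d.Regular) {u : F}
    (hu : d.IsSol c u) {g : ℝ} (hg : 0 < g) (hgap : HasGap (d.pencil u) g) {v : X}
    (hv : IsBottom (d.pencil u) v) {w : F} (hw : 0 ≤ d.slack (u + w)) : 0 ≤ d.gradCost c u v w := by
  set K := ‖w‖ ^ 2 + c * (8 / g * ‖d.slope w‖ * ‖d.slope w‖)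
  have key : ∀ s : ℝ, 0 < s → s ≤ 1 → 0 ≤ d.gradCost c u v w + s * K := by
    intro s hs hs1
    have hfeas : 0 ≤ d.slack (u + s • w) := by
      have h0 := hu.1
      rw [slack_add] at hw ⊢
      rw [real_inner_smul_right]
      nlinarith
    have hmin := hu.2 _ hfeas
    obtain ⟨v', hv'⟩ := exists_isBottom (d.pencil (u + s • w))
    have h1 := d.minRayleigh_pencil_le hv' u
    rw [show u - (u + s • w) = (-s) • w by module, map_smul, smul_apply,
      real_inner_smul_right] at h1
    have h2 := hgap.abs_inner_sub_inner_le (hd.pencil_symm u) (hd.pencil_symm (u + s • w)) hg hv hv'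
      (d.slope w)
    have h3 : ‖d.pencil u - d.pencil (u + s • w)‖ = s * ‖d.slope w‖ := by
      rw [pencil, pencil, map_add, map_smul,
        show d.base + d.slope u - (d.base + (d.slope u + s • d.slope w)) = -(s • d.slope w) by abel,
        norm_neg, norm_smul, Real.norm_of_nonneg hs.le]
    rw [h3] at h2
    have h4 := (abs_le.1 h2).1
    have h5 : ‖u + s • w - d.nominal‖ ^ 2 =
        ‖u - d.nominal‖ ^ 2 + 2 * s * ⟪u - d.nominal, w⟫_ℝ + s ^ 2 * ‖w‖ ^ 2 := by
      rw [show u + s • w - d.nominal = (u - d.nominal) + s • w by abel, norm_add_sq_real,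
        real_inner_smul_right, norm_smul, Real.norm_of_nonneg hs.le]
      ring
    unfold cost at hmin
    rw [h5] at hmin
    have h6 : 0 ≤ s * (2 * ⟪u - d.nominal, w⟫_ℝ + s * ‖w‖ ^ 2 - c * ⟪v', d.slope w v'⟫_ℝ) := by
      nlinarith [mul_le_mul_of_nonneg_left h1 hc]
    have h7 := nonneg_of_mul_nonneg_right h6 hs
    have h8 := mul_le_mul_of_nonneg_left h4 hc
    simp only [gradCost, K]
    linarith
  have hlim : Tendsto (fun s : ℝ => d.gradCost c u v w + s * K) (𝓝[>] 0)
      (𝓝 (d.gradCost c u v w + 0 * K)) := by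
    apply Tendsto.mono_left _ nhdsWithin_le_nhds
    exact Continuous.tendsto (by fun_prop) _
  rw [zero_mul, add_zero] at hlim
  refine ge_of_tendsto hlim ?_
  filter_upwards [Ioc_mem_nhdsGT (zero_lt_one' ℝ)] with s hs using key s hs.1 hs.2

/-- The Karush-Kuhn-Tucker conditions: the derivative of the cost is a nonnegative multiple of the
constraint normal, and the multiplier vanishes if the constraint is inactive. -/
theorem IsSol.exists_multiplier {c : ℝ} (hc : 0 ≤ c) {d : ProgramData F X} (hd : d.Regular) {u : F}
    (hu : d.IsSol c u) {g : ℝ} (hg : 0 < g) (hgap : HasGap (d.pencil u) g) {v : X}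
    (hv : IsBottom (d.pencil u) v) :
    ∃ μ : ℝ, 0 ≤ μ ∧ μ * d.slack u = 0 ∧ ∀ w, d.gradCost c u v w = μ * ⟪d.normal, w⟫_ℝ := by
  set a := d.normal
  have ha₀ : ‖a‖ ≠ 0 := norm_ne_zero_iff.2 hd.normal_ne
  have ha : ‖a‖ ^ 2 ≠ 0 := pow_ne_zero 2 ha₀
  have ha' : 0 < ‖a‖ ^ 2 := by positivity
  have hadd : ∀ w w', d.gradCost c u v (w + w') = d.gradCost c u v w + d.gradCost c u v w' := by
    intro w w'
    simp only [gradCost, inner_add_right, map_add, add_apply]; ring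
  have hsmul : ∀ (r : ℝ) w, d.gradCost c u v (r • w) = r * d.gradCost c u v w := by
    intro r w
    simp only [gradCost, real_inner_smul_right, map_smul, smul_apply]; ring
  have hVI : ∀ w, 0 ≤ d.slack u + ⟪a, w⟫_ℝ → 0 ≤ d.gradCost c u v w := fun w hw =>
    hu.gradCost_nonneg hc hd hg hgap hv (by rwa [slack_add])
  set μ := d.gradCost c u v a / ‖a‖ ^ 2 with hμ
  have hμa : d.gradCost c u v a = μ * ‖a‖ ^ 2 := by rw [hμ, div_mul_cancel₀ _ ha]
  have hμ0 : 0 ≤ μ := by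
    refine div_nonneg (hVI a ?_) ha'.le
    rw [real_inner_self_eq_norm_sq]; linarith [hu.1]
  refine ⟨μ, hμ0, ?_, fun w => ?_⟩
  · have h1 := hVI ((-(d.slack u / ‖a‖ ^ 2)) • a) (by
      rw [real_inner_smul_right, real_inner_self_eq_norm_sq, neg_mul, div_mul_cancel₀ _ ha]
      simp)
    rw [hsmul, hμa] at h1
    have h2 : -(d.slack u / ‖a‖ ^ 2) * (μ * ‖a‖ ^ 2) = -(μ * d.slack u) := by field_simp
    rw [h2] at h1
    exact le_antisymm (by linarith) (mul_nonneg hμ0 hu.1)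
  -- The derivative vanishes on the orthogonal complement of the normal, where both signs of a
  -- direction are feasible.
  · set k := w - (⟪a, w⟫_ℝ / ‖a‖ ^ 2) • a with hk
    have hak : ⟪a, k⟫_ℝ = 0 := by
      rw [hk, inner_sub_right, real_inner_smul_right, real_inner_self_eq_norm_sq,
        div_mul_cancel₀ _ ha, sub_self]
    have h1 := hVI k (by rw [hak, add_zero]; exact hu.1)
    have h2 := hVI ((-1 : ℝ) • k) (by
      rw [real_inner_smul_right, hak, mul_zero, add_zero]; exact hu.1)
    rw [hsmul] at h2
    have h3 : d.gradCost c u v k = 0 := le_antisymm (by linarith) h1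
    have h4 : w = k + (⟪a, w⟫_ℝ / ‖a‖ ^ 2) • a := by rw [hk]; abel
    conv_lhs => rw [h4]
    rw [hadd, hsmul, h3, hμa, zero_add]
    field_simp

/-- The derivative of the smallest eigenvalue along the pencil is Lipschitz in the data and the
control, if the lowest eigenvalue has a gap for one of the two pencils. -/
theorem abs_inner_slope_sub_le {B g : ℝ} (hB : 0 ≤ B) (hg : 0 < g) {d₁ d₂ : ProgramData F X}
    (hd₁ : d₁.Regular) (hd₂ : d₂.Regular) (h₁ : ‖d₁‖ ≤ B) (h₂ : ‖d₂‖ ≤ B) {u u₂ : F}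
    (hu₂ : ‖u₂‖ ≤ B) (hgap : HasGap (d₂.pencil u₂) g) {v v₂ : X} (hv : IsBottom (d₁.pencil u) v)
    (hv₂ : IsBottom (d₂.pencil u₂) v₂) (w : F) :
    |⟪v, d₁.slope w v⟫_ℝ - ⟪v₂, d₂.slope w v₂⟫_ℝ| ≤
      (1 + 8 / g * (1 + B) * B) * (‖d₁ - d₂‖ + ‖u - u₂‖) * ‖w‖ := by
  have e1 := hgap.abs_inner_sub_inner_le (hd₂.pencil_symm u₂) (hd₁.pencil_symm u) hg hv₂ hv
    (d₂.slope w)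
  have e2 := abs_inner_apply_self_le ((d₁.slope - d₂.slope) w) hv.1
  have e3 : ‖(d₁.slope - d₂.slope) w‖ ≤ ‖d₁ - d₂‖ * ‖w‖ :=
    ((d₁.slope - d₂.slope).le_opNorm w).trans
      (mul_le_mul_of_nonneg_right (norm_slope_sub_le _ _) (norm_nonneg w))
  have e4 : ‖d₂.slope w‖ ≤ B * ‖w‖ :=
    (d₂.slope.le_opNorm w).trans
      (mul_le_mul_of_nonneg_right ((norm_slope_le d₂).trans h₂) (norm_nonneg w))
  have hp := norm_pencil_sub_le (d₂ := d₂) h₁ u hu₂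
  have hδ0 : 0 ≤ ‖d₁ - d₂‖ := norm_nonneg (d₁ - d₂)
  set δ := ‖d₁ - d₂‖
  have hp' : ‖d₂.pencil u₂ - d₁.pencil u‖ ≤ (1 + B) * (δ + ‖u - u₂‖) := by
    linarith [norm_nonneg (u - u₂)]
  have e5 : 8 / g * ‖d₂.pencil u₂ - d₁.pencil u‖ * ‖d₂.slope w‖ ≤
      8 / g * ((1 + B) * (δ + ‖u - u₂‖)) * (B * ‖w‖) := by
    gcongr
  have e : ⟪v, d₁.slope w v⟫_ℝ - ⟪v₂, d₂.slope w v₂⟫_ℝ =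
      ⟪v, (d₁.slope - d₂.slope) w v⟫_ℝ + (⟪v, d₂.slope w v⟫_ℝ - ⟪v₂, d₂.slope w v₂⟫_ℝ) := by
    simp only [sub_apply, inner_sub_right]; ring
  rw [e]
  refine (abs_add_le _ _).trans ?_
  have e6 : δ * ‖w‖ ≤ (δ + ‖u - u₂‖) * ‖w‖ := by
    gcongr; linarith [norm_nonneg (u - u₂)]
  calc _ ≤ (δ + ‖u - u₂‖) * ‖w‖ + 8 / g * ((1 + B) * (δ + ‖u - u₂‖)) * (B * ‖w‖) := by
        linarith
    _ = (1 + 8 / g * (1 + B) * B) * (δ + ‖u - u₂‖) * ‖w‖ := by ring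

/-- The Lipschitz estimate for solutions of two programs with bounded data, gaps bounded below and
normals bounded away from zero.  It compares the two first-order conditions: strong convexity bounds
the difference of the derivatives from below, and complementarity of slack and multiplier
bounds it from above by products of two small quantities. -/
theorem exists_lipschitz_const {c : ℝ} (hc : 0 ≤ c) {B r g : ℝ} (hB : 0 ≤ B) (hr : 0 < r)
    (hg : 0 < g) :
    ∃ L : ℝ, 0 ≤ L ∧ ∀ (d₁ d₂ : ProgramData F X) (u₁ u₂ : F), d₁.Regular → d₂.Regular →
      ‖d₁‖ ≤ B → ‖d₂‖ ≤ B → r ≤ ‖d₁.normal‖ → r ≤ ‖d₂.normal‖ → ‖u₁‖ ≤ B → ‖u₂‖ ≤ B →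
      d₁.IsSol c u₁ → d₂.IsSol c u₂ → HasGap (d₁.pencil u₁) g → HasGap (d₂.pencil u₂) g →
      ‖u₁ - u₂‖ ≤ L * ‖d₁ - d₂‖ := by
  -- `A` bounds the variation of the gradient of the smallest eigenvalue, `G` the gradient of the
  -- cost, `M` the multipliers; `C₁` comes from the product of the variation of the multipliers
  -- with the mutual violation of the constraints.
  set A : ℝ := 1 + 8 / g * (1 + B) * B with hA
  set G : ℝ := 4 * B + c * B with hG
  set M : ℝ := G / r with hM
  set C₁ : ℝ := (2 + c * A + M) / r * (1 + B) with hC₁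
  have hA0 : 0 ≤ A := by positivity
  have hG0 : 0 ≤ G := by positivity
  have hM0 : 0 ≤ M := by positivity
  have hC₁0 : 0 ≤ C₁ := by positivity
  set N : ℝ := 2 + c * A + C₁ + M with hN
  have hN0 : 0 ≤ N := by positivity
  refine ⟨N + 1, by positivity, ?_⟩
  intro d₁ d₂ u₁ u₂ hd₁ hd₂ hB₁ hB₂ hr₁ hr₂ hu₁ hu₂ hs₁ hs₂ hg₁ hg₂
  set δ := ‖d₁ - d₂‖ with hδ
  set D := ‖u₁ - u₂‖ with hD
  have hδ0 : 0 ≤ δ := norm_nonneg (d₁ - d₂)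
  have hD0 : 0 ≤ D := norm_nonneg _
  obtain ⟨v₁, hv₁⟩ := exists_isBottom (d₁.pencil u₁)
  obtain ⟨v₂, hv₂⟩ := exists_isBottom (d₂.pencil u₂)
  obtain ⟨v', hv'⟩ := exists_isBottom (d₁.pencil u₂)
  obtain ⟨μ₁, hμ₁, hcomp₁, hgrad₁⟩ := hs₁.exists_multiplier hc hd₁ hg hg₁ hv₁
  obtain ⟨μ₂, hμ₂, hcomp₂, hgrad₂⟩ := hs₂.exists_multiplier hc hd₂ hg hg₂ hv₂
  have hquad : ∀ (u : F) (v : X), IsBottom (d₁.pencil u) v → ∀ w : F,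
      |⟪v, d₁.slope w v⟫_ℝ - ⟪v₂, d₂.slope w v₂⟫_ℝ| ≤ A * (δ + ‖u - u₂‖) * ‖w‖ := fun u v hv w =>
    abs_inner_slope_sub_le hB hg hd₁ hd₂ hB₁ hB₂ hu₂ hg₂ hv hv₂ w
  -- Upper bound for the difference of the two derivatives of the cost.
  have hGdiff : ∀ w, |d₁.gradCost c u₁ v₁ w - d₂.gradCost c u₂ v₂ w| ≤
      (2 + c * A) * (δ + D) * ‖w‖ := by
    intro w
    have h1 := mul_le_mul_of_nonneg_left (hquad u₁ v₁ hv₁ w) hc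
    have h2 : |⟪(u₁ - u₂) - (d₁.nominal - d₂.nominal), w⟫_ℝ| ≤ (δ + D) * ‖w‖ := by
      refine (abs_real_inner_le_norm _ _).trans ?_
      gcongr
      refine (norm_sub_le _ _).trans ?_
      linarith [norm_nominal_sub_le d₁ d₂]
    have e : d₁.gradCost c u₁ v₁ w - d₂.gradCost c u₂ v₂ w =
        2 * ⟪(u₁ - u₂) - (d₁.nominal - d₂.nominal), w⟫_ℝ
          - c * (⟪v₁, d₁.slope w v₁⟫_ℝ - ⟪v₂, d₂.slope w v₂⟫_ℝ) := by
      simp only [gradCost, inner_sub_left]; ring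
    rw [e]
    refine (abs_sub _ _).trans ?_
    rw [abs_mul, abs_mul, abs_of_nonneg hc, abs_two]
    linarith
  -- Lower bound, in the direction `u₁ - u₂`.
  have hlow : 2 * D ^ 2 - (2 + c * A) * δ * D ≤
      d₁.gradCost c u₁ v₁ (u₁ - u₂) - d₂.gradCost c u₂ v₂ (u₁ - u₂) := by
    have h1 := d₁.minRayleigh_pencil_le hv₁ u₂
    have h2 := d₁.minRayleigh_pencil_le hv' u₁
    have h3 : ⟪v₁, d₁.slope (u₂ - u₁) v₁⟫_ℝ = -⟪v₁, d₁.slope (u₁ - u₂) v₁⟫_ℝ := by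
      rw [← neg_sub u₁ u₂, map_neg, neg_apply, inner_neg_right]
    have h4 : ⟪v₁, d₁.slope (u₁ - u₂) v₁⟫_ℝ ≤ ⟪v', d₁.slope (u₁ - u₂) v'⟫_ℝ := by linarith
    have h5 := (abs_le.1 (hquad u₂ v' hv' (u₁ - u₂))).2
    rw [sub_self, norm_zero, add_zero] at h5
    have h6 := (abs_le.1 (abs_real_inner_le_norm (d₁.nominal - d₂.nominal) (u₁ - u₂))).2
    have h7 := mul_le_mul_of_nonneg_right (norm_nominal_sub_le d₁ d₂) hD0
    have e : d₁.gradCost c u₁ v₁ (u₁ - u₂) - d₂.gradCost c u₂ v₂ (u₁ - u₂) =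
        2 * D ^ 2 - 2 * ⟪d₁.nominal - d₂.nominal, u₁ - u₂⟫_ℝ
          - c * (⟪v₁, d₁.slope (u₁ - u₂) v₁⟫_ℝ - ⟪v₂, d₂.slope (u₁ - u₂) v₂⟫_ℝ) := by
      rw [hD, ← real_inner_self_eq_norm_sq]
      simp only [gradCost, inner_sub_left]; ring
    have h8 : c * (⟪v₁, d₁.slope (u₁ - u₂) v₁⟫_ℝ - ⟪v₂, d₂.slope (u₁ - u₂) v₂⟫_ℝ) ≤
        c * (A * δ * D) := mul_le_mul_of_nonneg_left (by linarith) hc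
    rw [e]
    linarith
  have hnormal : ‖d₁.normal - d₂.normal‖ ≤ δ := norm_normal_sub_le _ _
  have hμ₂M : μ₂ ≤ M := by
    have h1 := hgrad₂ d₂.normal
    rw [real_inner_self_eq_norm_sq] at h1
    have h2 := gradCost_le hc hB₂ hu₂ hv₂.1 d₂.normal
    rw [← hG] at h2
    have hpos : 0 < ‖d₂.normal‖ := hr.trans_le hr₂
    rw [hM, le_div_iff₀ hr]
    have h3 : μ₂ * ‖d₂.normal‖ ≤ G := by
      refine le_of_mul_le_mul_right ?_ hpos
      linarith
    exact (mul_le_mul_of_nonneg_left hr₂ hμ₂).trans h3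
  have hμdiff : |μ₁ - μ₂| ≤ (2 + c * A + M) / r * (δ + D) := by
    have h1 := hGdiff d₁.normal
    rw [hgrad₁, hgrad₂] at h1
    have hpos : 0 < ‖d₁.normal‖ := hr.trans_le hr₁
    have e : (μ₁ - μ₂) * ‖d₁.normal‖ ^ 2 =
        (μ₁ * ⟪d₁.normal, d₁.normal⟫_ℝ - μ₂ * ⟪d₂.normal, d₁.normal⟫_ℝ)
          - μ₂ * ⟪d₁.normal - d₂.normal, d₁.normal⟫_ℝ := by
      rw [inner_sub_left, ← real_inner_self_eq_norm_sq]; ring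
    have h2 : |μ₂ * ⟪d₁.normal - d₂.normal, d₁.normal⟫_ℝ| ≤ M * (δ + D) * ‖d₁.normal‖ := by
      rw [abs_mul, abs_of_nonneg hμ₂, mul_assoc]
      refine mul_le_mul hμ₂M ((abs_real_inner_le_norm _ _).trans ?_) (abs_nonneg _) hM0
      gcongr
      linarith
    have h3 : |μ₁ - μ₂| * ‖d₁.normal‖ ^ 2 ≤ (2 + c * A + M) * (δ + D) * ‖d₁.normal‖ := by
      rw [← abs_of_nonneg (sq_nonneg ‖d₁.normal‖), ← abs_mul, e]
      refine (abs_sub _ _).trans ?_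
      linarith
    have h4 : |μ₁ - μ₂| * ‖d₁.normal‖ ≤ (2 + c * A + M) * (δ + D) := by
      refine le_of_mul_le_mul_right ?_ hpos
      linarith
    rw [div_mul_eq_mul_div, le_div_iff₀ hr]
    exact (mul_le_mul_of_nonneg_left hr₁ (abs_nonneg _)).trans h4
  -- Complementarity, with `e` the violation of one constraint by the other solution.
  have hup : d₁.gradCost c u₁ v₁ (u₁ - u₂) - d₂.gradCost c u₂ v₂ (u₁ - u₂) ≤
      C₁ * (δ + D) * δ + M * δ * D := by
    set e := (d₁.offset - d₂.offset) + ⟪d₁.normal - d₂.normal, u₂⟫_ℝ with he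
    have he' : |e| ≤ (1 + B) * δ := by
      refine (abs_add_le _ _).trans ?_
      have h1 := abs_offset_sub_le d₁ d₂
      have h2 : |⟪d₁.normal - d₂.normal, u₂⟫_ℝ| ≤ δ * B :=
        (abs_real_inner_le_norm _ _).trans (mul_le_mul hnormal hu₂ (norm_nonneg _) hδ0)
      linarith
    have hid : d₁.gradCost c u₁ v₁ (u₁ - u₂) - d₂.gradCost c u₂ v₂ (u₁ - u₂) =
        -(μ₁ * d₂.slack u₂) - μ₂ * d₁.slack u₁ - (μ₁ - μ₂) * e
          + μ₂ * ⟪d₁.normal - d₂.normal, u₁ - u₂⟫_ℝ := by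
      rw [hgrad₁, hgrad₂, he]
      simp only [slack] at hcomp₁ hcomp₂ ⊢
      simp only [inner_sub_left, inner_sub_right]
      linear_combination hcomp₁ + hcomp₂
    have h1 := mul_nonneg hμ₁ hs₂.1
    have h2 := mul_nonneg hμ₂ hs₁.1
    have h3 : -((μ₁ - μ₂) * e) ≤ (2 + c * A + M) / r * (δ + D) * ((1 + B) * δ) := by
      refine (neg_le_abs _).trans ?_
      rw [abs_mul]
      exact mul_le_mul hμdiff he' (abs_nonneg _) (by positivity)
    have h4 : μ₂ * ⟪d₁.normal - d₂.normal, u₁ - u₂⟫_ℝ ≤ M * (δ * D) := by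
      refine (le_abs_self _).trans ?_
      rw [abs_mul, abs_of_nonneg hμ₂]
      exact mul_le_mul hμ₂M ((abs_real_inner_le_norm _ _).trans (by gcongr)) (abs_nonneg _) hM0
    have h5 : C₁ * (δ + D) * δ = (2 + c * A + M) / r * (δ + D) * ((1 + B) * δ) := by
      rw [hC₁]; ring
    rw [hid, h5]
    linarith
  have hfinal : D ^ 2 ≤ N * δ * D + N * δ ^ 2 := by
    have h1 := hlow.trans hup
    have h2 : 0 ≤ (2 + c * A + M) * δ ^ 2 := by positivity
    rw [hN]
    linarith [sq_nonneg D]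
  exact le_mul_of_sq_le hδ0 hD0 hfinal

/-- On a compact set of regular data on which the lowest eigenvalue of the pencil is simple at the
solution, the gaps have a common positive lower bound. -/
theorem exists_uniform_gap {K : Set (ProgramData F X)} (hK : IsCompact K)
    {σ : ProgramData F X → F} (hσ : ContinuousOn σ K)
    (hsimple : ∀ d ∈ K, ∀ v y, IsBottom (d.pencil (σ d)) v → ‖y‖ = 1 → ⟪v, y⟫_ℝ = 0 →
      minRayleigh (d.pencil (σ d)) < ⟪y, d.pencil (σ d) y⟫_ℝ) :
    ∃ g, 0 < g ∧ ∀ d ∈ K, HasGap (d.pencil (σ d)) g := by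
  have : ProperSpace X := FiniteDimensional.proper_real X
  have : CompactSpace K := isCompact_iff_compactSpace.1 hK
  have hσ' : Continuous fun p : K × X × X => p.1.1.pencil (σ p.1.1) :=
    continuous_pencil.comp ((continuous_subtype_val.comp continuous_fst).prodMk
      (hσ.domRestrict.comp continuous_fst))
  have hm : Continuous fun p : K × X × X => minRayleigh (p.1.1.pencil (σ p.1.1)) :=
    continuous_minRayleigh.comp hσ'
  have hq : ∀ f : K × X × X → X, Continuous f →
      Continuous fun p => ⟪f p, p.1.1.pencil (σ p.1.1) (f p)⟫_ℝ := fun f hf =>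
    hf.inner (hσ'.clm_apply hf)
  have h1 : Continuous fun p : K × X × X => p.2.1 := by fun_prop
  have h2 : Continuous fun p : K × X × X => p.2.2 := by fun_prop
  set W : Set (K × X × X) := (univ ×ˢ Metric.sphere 0 1 ×ˢ Metric.sphere 0 1) ∩
    {p | ⟪p.2.1, p.1.1.pencil (σ p.1.1) p.2.1⟫_ℝ = minRayleigh (p.1.1.pencil (σ p.1.1))} ∩
    {p | ⟪p.2.1, p.2.2⟫_ℝ = 0} with hW
  have hWc : IsCompact W :=
    ((isCompact_univ.prod ((isCompact_sphere _ _).prod (isCompact_sphere _ _))).inter_right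
      (isClosed_eq (hq _ h1) hm)).inter_right (isClosed_eq (h1.inner h2) continuous_const)
  obtain ⟨g, hg, hgW⟩ := hWc.exists_forall_le' (f := fun p =>
    ⟪p.2.2, p.1.1.pencil (σ p.1.1) p.2.2⟫_ℝ - minRayleigh (p.1.1.pencil (σ p.1.1)))
    ((hq _ h2).sub hm).continuousOn (a := 0) (by
      rintro ⟨⟨d, hd⟩, v, y⟩ ⟨⟨⟨-, hv, hy⟩, hb⟩, ho⟩
      exact sub_pos.2 (hsimple d hd v y ⟨by simpa using hv, hb⟩ (by simpa using hy) ho))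
  refine ⟨g, hg, fun d hd v y hv hy ho => ?_⟩
  have := hgW (⟨d, hd⟩, v, y) ⟨⟨⟨mem_univ _, by simpa using hv.1, by simpa using hy⟩, hv.2⟩, ho⟩
  simp only at this
  linarith

/-- Solutions are Lipschitz in the data on compact sets of regular data on which the lowest
eigenvalue of the pencil is simple at the solution. -/
theorem exists_lipschitzOnWith [FiniteDimensional ℝ F] {c : ℝ} (hc : 0 ≤ c)
    {K : Set (ProgramData F X)} (hK : IsCompact K)
    (hreg : ∀ d ∈ K, d.Regular) {σ : ProgramData F X → F} (hsol : ∀ d ∈ K, d.IsSol c (σ d))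
    (hsimple : ∀ d ∈ K, ∀ v y, IsBottom (d.pencil (σ d)) v → ‖y‖ = 1 → ⟪v, y⟫_ℝ = 0 →
      minRayleigh (d.pencil (σ d)) < ⟪y, d.pencil (σ d) y⟫_ℝ) :
    ∃ L : ℝ≥0, LipschitzOnWith L σ K := by
  have hσ : ContinuousOn σ K := fun d hd =>
    tendsto_isSol hc (hreg d hd).normal_ne (continuousWithinAt_id (s := K)).tendsto
      (eventually_mem_nhdsWithin.mono fun d' hd' => hsol d' hd') (hsol d hd)
  obtain ⟨g, hg, hgap⟩ := exists_uniform_gap hK hσ hsimple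
  obtain ⟨B₁, hB₁⟩ :=
    hK.exists_bound_of_continuousOn (f := fun d : ProgramData F X => d) continuousOn_id
  obtain ⟨B₂, hB₂⟩ := (hK.image_of_continuousOn hσ).isBounded.exists_norm_le
  obtain ⟨r, hr, hrK⟩ := hK.exists_forall_le' (f := fun d : ProgramData F X => ‖d.normal‖)
    (by fun_prop) (a := 0) fun d hd => norm_pos_iff.2 (hreg d hd).normal_ne
  obtain ⟨L, hL, hLip⟩ := exists_lipschitz_const (F := F) (X := X) hc
    (le_max_left 0 (max B₁ B₂)) hr hg
  have b₁ : ∀ d ∈ K, ‖d‖ ≤ max 0 (max B₁ B₂) := fun d hd =>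
    (hB₁ d hd).trans ((le_max_left _ _).trans (le_max_right _ _))
  have b₂ : ∀ d ∈ K, ‖σ d‖ ≤ max 0 (max B₁ B₂) := fun d hd =>
    (hB₂ _ (mem_image_of_mem σ hd)).trans ((le_max_right _ _).trans (le_max_right _ _))
  refine ⟨L.toNNReal, LipschitzOnWith.of_dist_le_mul (α := ProgramData F X) fun d hd d' hd' => ?_⟩
  rw [dist_eq_norm (σ d), dist_eq_norm d d', Real.coe_toNNReal L hL]
  exact hLip d d' _ _ (hreg d hd) (hreg d' hd') (b₁ d hd) (b₁ d' hd') (hrK d hd) (hrK d' hd')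
    (b₂ d hd) (b₂ d' hd') (hsol d hd) (hsol d' hd') (hgap d hd) (hgap d' hd')

end ProgramData

end Lipschitz

/-! ### Eigenvalues of symmetric matrices -/

section Matrices

open scoped InnerProductSpace

variable {n : ℕ}

/-- The operator on Euclidean space with the given matrix, as a linear function of the matrix. -/
noncomputable def matrixCLM (n : ℕ) : Matrix (Fin n) (Fin n) ℝ →ₗ[ℝ] (E n →L[ℝ] E n) where
  toFun := Matrix.toEuclideanCLM (𝕜 := ℝ)
  map_add' := map_add _
  map_smul' := map_smul _

theorem matrixCLM_apply (M : Matrix (Fin n) (Fin n) ℝ) (x : E n) :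
    matrixCLM n M x = Matrix.toEuclideanLin M x := rfl

theorem isSymmetric_matrixCLM {M : Matrix (Fin n) (Fin n) ℝ} (hM : M.IsHermitian) :
    (matrixCLM n M).IsSymmetric :=
  Matrix.isSymmetric_toEuclideanLin_iff.2 hM

theorem matrixCLM_eigenvectorBasis {M : Matrix (Fin n) (Fin n) ℝ} (hM : M.IsHermitian)
    (i : Fin n) :
    matrixCLM n M (hM.eigenvectorBasis i) = hM.eigenvalues i • hM.eigenvectorBasis i := by
  rw [matrixCLM_apply]
  ext j
  have := congrFun (hM.mulVec_eigenvectorBasis i) j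
  simpa [Matrix.toLpLin_apply] using this

/-- A coordinate of an eigenvector in the eigenbasis vanishes unless the eigenvalues agree. -/
theorem eigenvalues_eq_of_inner_ne_zero {M : Matrix (Fin n) (Fin n) ℝ} (hM : M.IsHermitian)
    {m : ℝ} {v : E n} (hv : matrixCLM n M v = m • v) {i : Fin n}
    (hi : ⟪hM.eigenvectorBasis i, v⟫_ℝ ≠ 0) : hM.eigenvalues i = m := by
  have h1 : ⟪matrixCLM n M (hM.eigenvectorBasis i), v⟫_ℝ =
      ⟪hM.eigenvectorBasis i, matrixCLM n M v⟫_ℝ := isSymmetric_matrixCLM hM _ _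
  rw [matrixCLM_eigenvectorBasis, hv, real_inner_smul_left, real_inner_smul_right] at h1
  exact mul_right_cancel₀ hi h1

theorem exists_inner_eigenvectorBasis_ne_zero {M : Matrix (Fin n) (Fin n) ℝ} (hM : M.IsHermitian)
    {v : E n} (hv : ‖v‖ = 1) : ∃ i, ⟪hM.eigenvectorBasis i, v⟫_ℝ ≠ 0 := by
  by_contra! h
  have : v = 0 := by
    rw [← hM.eigenvectorBasis.sum_repr' v]
    exact Finset.sum_eq_zero fun i _ => by rw [h i, zero_smul]
  simp [this] at hv

theorem lambdaMin_eq_minRayleigh [Nontrivial (E n)] {M : Matrix (Fin n) (Fin n) ℝ}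
    (hM : M.IsHermitian) : lambdaMin M = minRayleigh (matrixCLM n M) := by
  obtain ⟨v, hv⟩ := exists_isBottom (matrixCLM n M)
  obtain ⟨i, hi⟩ := exists_inner_eigenvectorBasis_ne_zero hM hv.1
  have him := eigenvalues_eq_of_inner_ne_zero hM (hv.apply_eq (isSymmetric_matrixCLM hM)) hi
  rw [lambdaMin, hM.spectrum_real_eq_range_eigenvalues]
  refine IsLeast.csInf_eq ⟨⟨i, him⟩, ?_⟩
  rintro _ ⟨j, rfl⟩
  have h1 := minRayleigh_le (matrixCLM n M) (hM.eigenvectorBasis.orthonormal.1 j)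
  rwa [matrixCLM_eigenvectorBasis, real_inner_smul_right, real_inner_self_eq_norm_sq,
    hM.eigenvectorBasis.orthonormal.1 j, one_pow, mul_one] at h1

/-- If the eigenvalues are distinct, the eigenspace of the smallest one is a line. -/
theorem DistinctEigenvalues.minRayleigh_lt [Nontrivial (E n)] {M : Matrix (Fin n) (Fin n) ℝ}
    (h : DistinctEigenvalues M) {v y : E n} (hv : IsBottom (matrixCLM n M) v) (hy : ‖y‖ = 1)
    (hvy : ⟪v, y⟫_ℝ = 0) : minRayleigh (matrixCLM n M) < ⟪y, matrixCLM n M y⟫_ℝ := by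
  obtain ⟨hM, hinj⟩ := h
  have hsymm := isSymmetric_matrixCLM hM
  refine lt_of_le_of_ne (minRayleigh_le _ hy) fun heq => ?_
  have hv' := hv.apply_eq hsymm
  have hy' := IsBottom.apply_eq hsymm ⟨hy, heq.symm⟩
  obtain ⟨i, hi⟩ := exists_inner_eigenvectorBasis_ne_zero hM hv.1
  obtain ⟨j, hj⟩ := exists_inner_eigenvectorBasis_ne_zero hM hy
  have hij : ∀ k, ⟪hM.eigenvectorBasis k, v⟫_ℝ ≠ 0 → k = j := fun k hk =>
    hinj ((eigenvalues_eq_of_inner_ne_zero hM hv' hk).trans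
      (eigenvalues_eq_of_inner_ne_zero hM hy' hj).symm)
  rw [← hM.eigenvectorBasis.sum_inner_mul_inner v y, Finset.sum_eq_single j] at hvy
  · rw [← hij i hi, real_inner_comm] at hvy
    rcases mul_eq_zero.1 hvy with h0 | h0
    · exact hi h0
    · exact hj (hij i hi ▸ h0)
  · intro k _ hk
    by_contra hne
    exact hk (hij k fun h0 => hne (by rw [real_inner_comm, h0, zero_mul]))
  · exact fun h0 => absurd (Finset.mem_univ j) h0

theorem posDef_of_sub_smul_one {M : Matrix (Fin n) (Fin n) ℝ} {c : ℝ} (hc : 0 < c)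
    (hM : (M - c • (1 : Matrix (Fin n) (Fin n) ℝ)).PosSemidef) : M.PosDef := by
  have := Matrix.PosDef.posSemidef_add hM (Matrix.PosDef.smul Matrix.PosDef.one hc)
  rwa [sub_add_cancel] at this

theorem isClosed_posSemidef : IsClosed {M : Matrix (Fin n) (Fin n) ℝ | M.PosSemidef} := by
  simp only [Matrix.posSemidef_iff_dotProduct_mulVec, ofPred_and, ofPred_forall]
  refine (isClosed_eq (by fun_prop) continuous_id).inter (isClosed_iInter fun x => ?_)
  exact isClosed_le continuous_const (by fun_prop)

theorem continuousAt_inv_of_posDef {M : Matrix (Fin n) (Fin n) ℝ} (hM : M.PosDef) :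
    ContinuousAt (fun A : Matrix (Fin n) (Fin n) ℝ => A⁻¹) M := by
  refine continuousAt_matrix_inv _ ?_
  rw [Ring.inverse_eq_inv']
  exact continuousAt_inv₀ hM.det_pos.ne'

end Matrices

/-! ### The data of the confidence-aware program are smooth -/

section EntrywiseC1

variable {V : Type*} [NormedAddCommGroup V] [NormedSpace ℝ V] {m n k : ℕ}

/-- All entries of the matrix-valued function `M` are `C¹` at `p`. -/
def EntrywiseC1 (M : V → Matrix (Fin m) (Fin n) ℝ) (p : V) : Prop :=
  ∀ i j, ContDiffAt ℝ 1 (fun x => M x i j) p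

namespace EntrywiseC1

variable {M N : V → Matrix (Fin m) (Fin n) ℝ} {p : V}

theorem const (A : Matrix (Fin m) (Fin n) ℝ) : EntrywiseC1 (fun _ => A) p :=
  fun _ _ => contDiffAt_const

theorem add (hM : EntrywiseC1 M p) (hN : EntrywiseC1 N p) : EntrywiseC1 (fun x => M x + N x) p :=
  fun i j => (hM i j).add (hN i j)

theorem sub (hM : EntrywiseC1 M p) (hN : EntrywiseC1 N p) : EntrywiseC1 (fun x => M x - N x) p :=
  fun i j => (hM i j).sub (hN i j)

theorem neg (hM : EntrywiseC1 M p) : EntrywiseC1 (fun x => -M x) p :=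
  fun i j => (hM i j).neg

theorem smul (r : ℝ) (hM : EntrywiseC1 M p) : EntrywiseC1 (fun x => r • M x) p :=
  fun i j => contDiffAt_const.mul (hM i j)

theorem transpose (hM : EntrywiseC1 M p) : EntrywiseC1 (fun x => (M x)ᵀ) p :=
  fun i j => hM j i

theorem mul {N : V → Matrix (Fin n) (Fin k) ℝ} (hM : EntrywiseC1 M p) (hN : EntrywiseC1 N p) :
    EntrywiseC1 (fun x => M x * N x) p := fun i j => by
  simp only [Matrix.mul_apply]
  exact ContDiffAt.sum fun l _ => (hM i l).mul (hN l j)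

theorem toEuclideanLin {w : V → E n} (hM : EntrywiseC1 M p) (hw : ContDiffAt ℝ 1 w p) :
    ContDiffAt ℝ 1 (fun x => Matrix.toEuclideanLin (M x) (w x)) p := by
  rw [contDiffAt_euclidean] at hw ⊢
  intro i
  simp only [Matrix.toLpLin_apply, Matrix.mulVec, dotProduct]
  exact ContDiffAt.sum fun l _ => (hM i l).mul (hw l)

theorem matrixCLM {M : V → Matrix (Fin n) (Fin n) ℝ} (hM : EntrywiseC1 M p) :
    ContDiffAt ℝ 1 (fun x => matrixCLM n (M x)) p := by
  have h : ContDiffAt ℝ 1 (fun x => Matrix.of.symm (M x)) p :=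
    contDiffAt_pi.2 fun i => contDiffAt_pi.2 fun j => hM i j
  exact (LinearMap.toContinuousLinearMap (ConfidenceCBF.matrixCLM n ∘ₗ
    (Matrix.ofLinearEquiv ℝ).toLinearMap)).contDiff.contDiffAt.comp p h

end EntrywiseC1

theorem entrywiseC1_jacobian {φ : E n → E m} {w : V → E n} {p : V} (hφ : ContDiffAt ℝ 2 φ (w p))
    (hw : ContDiffAt ℝ 1 w p) : EntrywiseC1 (fun x => jacobian φ (w x)) p := fun i k => by
  have h1 : ContDiffAt ℝ 1 (fun x => fderiv ℝ φ (w x)) p :=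
    (hφ.fderiv_right (m := 1) le_rfl).comp p hw
  exact contDiffAt_euclidean.1 (h1.clm_apply contDiffAt_const) i

end EntrywiseC1

section Data

open scoped InnerProductSpace

variable {nx nu nz : ℕ}

/-- Parameters `(P, S, xh, z)` of the program.  Treating `S = P⁻¹` as a separate coordinate makes
the data of the program polynomial in `P` and `S`. -/
abbrev Param (nx nz : ℕ) := (Fin nx → Fin nx → ℝ) × (Fin nx → Fin nx → ℝ) × E nx × E nz

/-- The `j`-th coefficient matrix `∂g_j/∂x` of the control in `A(xh, u)`. -/
noncomputable def jacobianCol (sys : Plant nx nu nz) (xh : E nx) (j : Fin nu) :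
    Matrix (Fin nx) (Fin nx) ℝ :=
  Matrix.of fun i k => fderiv ℝ (fun y => sys.g y i j) xh (EuclideanSpace.single k 1)

theorem matA_eq (sys : Plant nx nu nz) (xh : E nx) (u : E nu) :
    matA sys xh u = jacobian sys.f xh + ∑ j, u j • jacobianCol sys xh j := by
  ext i k
  simp [matA, jacobianCol, Matrix.sum_apply, mul_comm]

/-- The `j`-th coefficient matrix of the control in the predicted confidence. -/
noncomputable def nextSCol (sys : Plant nx nu nz) (Δt : ℝ) (S : Matrix (Fin nx) (Fin nx) ℝ)
    (xh : E nx) (j : Fin nu) : Matrix (Fin nx) (Fin nx) ℝ :=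
  Δt • (-((jacobianCol sys xh j)ᵀ * S) - S * jacobianCol sys xh j)

theorem nextS_eq (sys : Plant nx nu nz) (obs : ObserverParams nx nz) (Δt : ℝ)
    (S : Matrix (Fin nx) (Fin nx) ℝ) (xh : E nx) (u : E nu) :
    nextS sys obs Δt S xh u =
      nextS sys obs Δt S xh 0 + ∑ j, u j • nextSCol sys Δt S xh j := by
  have h : ∑ j, u j • nextSCol sys Δt S xh j =
      Δt • (-((∑ j, u j • jacobianCol sys xh j)ᵀ * S) - S * ∑ j, u j • jacobianCol sys xh j) := by
    simp only [nextSCol, Matrix.transpose_sum, Matrix.transpose_smul, Finset.sum_mul,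
      Finset.mul_sum, Matrix.smul_mul, Matrix.mul_smul, smul_sub, smul_neg, Finset.smul_sum,
      Finset.sum_sub_distrib, Finset.sum_neg_distrib, smul_comm Δt]
  have h0 : matA sys xh 0 = jacobian sys.f xh := by simp [matA_eq]
  rw [h, nextS, nextS, h0, matA_eq, Matrix.transpose_add, add_mul, mul_add]
  module

/-- The linear functional `L_g h (x)` as a vector of controls. -/
noncomputable def lieGVec (sys : Plant nx nu nz) (h : E nx → ℝ) (x : E nx) : E nu :=
  WithLp.toLp 2 fun j => lieG sys h x (EuclideanSpace.single j 1)

theorem inner_lieGVec (sys : Plant nx nu nz) (h : E nx → ℝ) (x : E nx) (u : E nu) :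
    ⟪lieGVec sys h x, u⟫_ℝ = lieG sys h x u := by
  have hu : u = ∑ j, u j • EuclideanSpace.single j (1 : ℝ) := by
    ext i
    simp [Finset.sum_apply, Pi.single_apply]
  conv_rhs => rw [hu, map_sum]
  simp [lieGVec, PiLp.inner_apply]

/-- The parameters that belong to the uncertainty `P`. -/
noncomputable def toParam (P : Matrix (Fin nx) (Fin nx) ℝ) (xh : E nx) (z : E nz) : Param nx nz :=
  (Matrix.of.symm P, Matrix.of.symm P⁻¹, xh, z)

/-- The data of the confidence-aware program as a function of its parameters. -/
noncomputable def programData (sys : Plant nx nu nz) (obs : ObserverParams nx nz) (h : E nx → ℝ)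
    (α : ℝ) (πn : E nx → E nu) (Δt : ℝ) (p : Param nx nz) : ProgramData (E nu) (E nx) :=
  (πn p.2.2.1,
    matrixCLM nx (nextS sys obs Δt (Matrix.of p.2.1) p.2.2.1 0),
    ∑ j, (EuclideanSpace.proj j : E nu →L[ℝ] ℝ).smulRight
      (matrixCLM nx (nextSCol sys Δt (Matrix.of p.2.1) p.2.2.1 j)),
    lieGVec sys h p.2.2.1,
    lieF sys h p.2.2.1 + α * h p.2.2.1
      + fderiv ℝ h p.2.2.1 (injection sys obs (Matrix.of p.1) p.2.2.1 p.2.2.2))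

variable {sys : Plant nx nu nz} {obs : ObserverParams nx nz} {h : E nx → ℝ} {α : ℝ}
  {πn : E nx → E nu} {Δt : ℝ}

theorem pencil_programData (p : Param nx nz) (u : E nu) :
    (programData sys obs h α πn Δt p).pencil u =
      matrixCLM nx (nextS sys obs Δt (Matrix.of p.2.1) p.2.2.1 u) := by
  rw [nextS_eq, ProgramData.pencil, map_add, map_sum]
  simp [programData, ProgramData.base, ProgramData.slope]

theorem slack_programData (p : Param nx nz) (u : E nu) :
    (programData sys obs h α πn Δt p).slack u =
      lieF sys h p.2.2.1 + lieG sys h p.2.2.1 u + α * h p.2.2.1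
        + fderiv ℝ h p.2.2.1 (injection sys obs (Matrix.of p.1) p.2.2.1 p.2.2.2) := by
  rw [ProgramData.slack, programData, ProgramData.normal, inner_lieGVec]
  ring

theorem isHermitian_conj_inv {m n : ℕ} {R : Matrix (Fin m) (Fin m) ℝ} (hR : R.IsHermitian)
    (C : Matrix (Fin m) (Fin n) ℝ) : (Cᵀ * R⁻¹ * C).IsHermitian := by
  have := Matrix.isHermitian_conjTranspose_mul_mul C hR.inv
  rwa [Matrix.conjTranspose_eq_transpose_of_trivial] at this

theorem isHermitian_nextS (hobs : obs.Standing) {S : Matrix (Fin nx) (Fin nx) ℝ}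
    (hS : S.IsHermitian) (xh : E nx) (u : E nu) : (nextS sys obs Δt S xh u).IsHermitian := by
  have hC := isHermitian_conj_inv hobs.R_posDef.isHermitian (matC sys xh)
  have hQ := hobs.Q_posDef.isHermitian
  simp only [Matrix.IsHermitian, Matrix.conjTranspose_eq_transpose_of_trivial] at hS hC hQ ⊢
  simp only [nextS, Matrix.transpose_add, Matrix.transpose_smul, Matrix.transpose_sub,
    Matrix.transpose_neg, hC]
  simp only [Matrix.transpose_mul, Matrix.transpose_transpose, hS, hQ, Matrix.mul_assoc]
  congr 2
  abel

theorem regular_programData (hobs : obs.Standing) {p : Param nx nz}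
    (hS : (Matrix.of p.2.1).IsHermitian)
    (hrel : lieG sys h p.2.2.1 ≠ 0) : (programData sys obs h α πn Δt p).Regular where
  normal_ne h0 := hrel <| LinearMap.ext fun u => by
    rw [← inner_lieGVec, show lieGVec sys h p.2.2.1 = 0 from h0, inner_zero_left,
      LinearMap.zero_apply]
  base_symm := isSymmetric_matrixCLM (isHermitian_nextS hobs hS _ _)
  slope_symm u := by
    have h1 := pencil_programData (sys := sys) (obs := obs) (h := h) (α := α) (πn := πn) (Δt := Δt)
      p u
    rw [ProgramData.pencil, ← eq_sub_iff_add_eq'] at h1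
    rw [h1]
    exact LinearMap.IsSymmetric.sub (isSymmetric_matrixCLM (isHermitian_nextS hobs hS _ _))
      (isSymmetric_matrixCLM (isHermitian_nextS hobs hS _ _))

theorem isSol_programData_iff [Nontrivial (E nx)] (hobs : obs.Standing) {c : ℝ}
    {P : Matrix (Fin nx) (Fin nx) ℝ} (hP : P⁻¹.IsHermitian) (xh : E nx) (z : E nz) (u : E nu) :
    (programData sys obs h α πn Δt (toParam P xh z)).IsSol c u ↔
      IsMinimizer sys obs h α πn c Δt P xh z u := by
  have hcost : ∀ v, (programData sys obs h α πn Δt (toParam P xh z)).cost c v =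
      objective sys obs πn c Δt P xh v := fun v => by
    rw [ProgramData.cost, pencil_programData, objective,
      lambdaMin_eq_minRayleigh (isHermitian_nextS hobs hP _ _)]
    simp only [toParam, programData, Equiv.apply_symm_apply]
  simp only [ProgramData.IsSol, IsMinimizer, cbfFeasible, mem_ofPred_eq, slack_programData, hcost]
  simp only [toParam, Equiv.apply_symm_apply]

variable (obs α Δt) in
/-- The data other than the nominal control are `C¹`. -/
theorem contDiffAt_programData_snd (hsys : sys.Standing)
    (hh : ∀ x ∈ sys.X ∪ sys.Xhat, ContDiffAt ℝ 2 h x) {p : Param nx nz}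
    (hp : p.2.2.1 ∈ sys.Xhat) :
    ContDiffAt ℝ 1 (fun p => (programData sys obs h α πn Δt p).2) p := by
  have hx : p.2.2.1 ∈ sys.X ∪ sys.Xhat := Or.inr hp
  have hX : ContDiffAt ℝ 1 (fun p : Param nx nz => p.2.2.1) p := by fun_prop
  have hZ : ContDiffAt ℝ 1 (fun p : Param nx nz => p.2.2.2) p := by fun_prop
  have hP : EntrywiseC1 (fun p : Param nx nz => Matrix.of p.1) p :=
    fun i j => by simp only [Matrix.of_apply]; fun_prop
  have hS : EntrywiseC1 (fun p : Param nx nz => Matrix.of p.2.1) p :=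
    fun i j => by simp only [Matrix.of_apply]; fun_prop
  have hC : EntrywiseC1 (fun p : Param nx nz => matC sys p.2.2.1) p :=
    entrywiseC1_jacobian (hsys.q_smooth _ hx) hX
  have hG : ∀ j, EntrywiseC1 (fun p : Param nx nz => jacobianCol sys p.2.2.1 j) p :=
    fun j i k => (((hsys.g_smooth _ hx i j).fderiv_right (m := 1) le_rfl).comp p hX).clm_apply
      contDiffAt_const
  have hA : EntrywiseC1 (fun p : Param nx nz => matA sys p.2.2.1 (0 : E nu)) p := by
    have h0 : ∀ x, matA sys x (0 : E nu) = jacobian sys.f x := by simp [matA_eq]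
    simp only [h0]
    exact entrywiseC1_jacobian (hsys.f_smooth _ hx) hX
  have hh1 : ContDiffAt ℝ 1 (fun p : Param nx nz => h p.2.2.1) p :=
    ((hh _ hx).of_le one_le_two).comp p hX
  have hdh : ContDiffAt ℝ 1 (fun p : Param nx nz => fderiv ℝ h p.2.2.1) p :=
    ((hh _ hx).fderiv_right (m := 1) le_rfl).comp p hX
  have hf : ContDiffAt ℝ 1 (fun p : Param nx nz => sys.f p.2.2.1) p :=
    ((hsys.f_smooth _ hx).of_le one_le_two).comp p hX
  have hq : ContDiffAt ℝ 1 (fun p : Param nx nz => sys.q p.2.2.1) p :=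
    ((hsys.q_smooth _ hx).of_le one_le_two).comp p hX
  have hg : EntrywiseC1 (fun p : Param nx nz => sys.g p.2.2.1) p := fun i j =>
    ((hsys.g_smooth _ hx i j).of_le one_le_two).comp (f := fun p : Param nx nz => p.2.2.1) p hX
  have hinj : ContDiffAt ℝ 1
      (fun p : Param nx nz => injection sys obs (Matrix.of p.1) p.2.2.1 p.2.2.2) p :=
    ((hP.mul hC.transpose).mul (.const _)).toEuclideanLin (hZ.sub hq)
  have hbase := EntrywiseC1.matrixCLM <| hS.add <| EntrywiseC1.smul Δt <|
    ((((hS.smul obs.κ).neg.sub (hA.transpose.mul hS)).sub (hS.mul hA)).add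
      ((hC.transpose.mul (.const obs.R⁻¹)).mul hC)).sub ((hS.mul (.const obs.Q)).mul hS)
  have hcol : ∀ j, ContDiffAt ℝ 1
      (fun p : Param nx nz => matrixCLM nx (nextSCol sys Δt (Matrix.of p.2.1) p.2.2.1 j)) p := fun j =>
    EntrywiseC1.matrixCLM <| EntrywiseC1.smul Δt <|
      ((hG j).transpose.mul hS).neg.sub (hS.mul (hG j))
  have hslope : ContDiffAt ℝ 1 (fun p : Param nx nz =>
      ∑ j, (EuclideanSpace.proj j : E nu →L[ℝ] ℝ).smulRight
        (matrixCLM nx (nextSCol sys Δt (Matrix.of p.2.1) p.2.2.1 j))) p :=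
    ContDiffAt.sum fun j _ => ContDiffAt.smulRight contDiffAt_const (hcol j)
  have hnormal : ContDiffAt ℝ 1 (fun p : Param nx nz => lieGVec sys h p.2.2.1) p :=
    contDiffAt_euclidean.2 fun j => hdh.clm_apply (hg.toEuclideanLin contDiffAt_const)
  exact hbase.prodMk (hslope.prodMk (hnormal.prodMk
    (((hdh.clm_apply hf).add (contDiffAt_const.mul hh1)).add (hdh.clm_apply hinj))))

theorem locallyLipschitzOn_programData (hsys : sys.Standing)
    (hh : ∀ x ∈ sys.X ∪ sys.Xhat, ContDiffAt ℝ 2 h x)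
    (hπn : ∃ K : ℝ≥0, LipschitzOnWith K πn sys.Xhat) :
    LocallyLipschitzOn {p : Param nx nz | p.2.2.1 ∈ sys.Xhat}
      (programData sys obs h α πn Δt) := by
  obtain ⟨K, hK⟩ := hπn
  intro p hp
  obtain ⟨L, t, ht, hL⟩ :=
    (contDiffAt_programData_snd obs α Δt hsys hh (πn := πn) hp).exists_lipschitzOnWith
  have hfst : LipschitzWith 1 fun p : Param nx nz => p.2.2.1 := by
    have h1 : LipschitzWith (1 * (1 * 1)) fun p : Param nx nz => p.2.2.1 :=
      LipschitzWith.prod_fst.comp (LipschitzWith.prod_snd.comp LipschitzWith.prod_snd)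
    simpa using h1
  have h1 : LipschitzOnWith (K * 1) (fun p : Param nx nz => πn p.2.2.1)
      {p : Param nx nz | p.2.2.1 ∈ sys.Xhat} :=
    hK.comp hfst.lipschitzOnWith fun q hq => hq
  refine ⟨max (K * 1) L, {p : Param nx nz | p.2.2.1 ∈ sys.Xhat} ∩ t,
    inter_mem self_mem_nhdsWithin (mem_nhdsWithin_of_mem_nhds ht), ?_⟩
  exact (h1.mono inter_subset_left).prodMk (hL.mono inter_subset_right)

end Data

/-! ### The controller -/

section Controller

open scoped InnerProductSpace

variable {nx nu nz : ℕ} {sys : Plant nx nu nz} {obs : ObserverParams nx nz} {h : E nx → ℝ} {α : ℝ}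
  {πn : E nx → E nu} {Δt : ℝ}

/-- A nonzero derivative along the input directions requires a state space of positive dimension. -/
theorem nontrivial_of_lieG_ne_zero {x : E nx} (hx : lieG sys h x ≠ 0) : Nontrivial (E nx) := by
  by_contra hcon
  rw [not_nontrivial_iff_subsingleton] at hcon
  refine hx (LinearMap.ext fun u => ?_)
  rw [lieG, LinearMap.comp_apply, Subsingleton.elim (Matrix.toEuclideanLin (sys.g x) u) 0, map_zero,
    LinearMap.zero_apply]

theorem exists_isMinimizer [Nontrivial (E nx)] (hobs : obs.Standing) {c₁ : ℝ} (hc₁ : 0 ≤ c₁)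
    {P : Matrix (Fin nx) (Fin nx) ℝ} (hP : P.PosDef) {xh : E nx} (hrel : lieG sys h xh ≠ 0)
    (z : E nz) : ∃ u, IsMinimizer sys obs h α πn c₁ Δt P xh z u := by
  have hreg := regular_programData (α := α) (πn := πn) (Δt := Δt) hobs (p := toParam P xh z)
    hP.isHermitian.inv hrel
  obtain ⟨u, hu⟩ := ProgramData.exists_isSol hc₁ hreg.normal_ne
  exact ⟨u, (isSol_programData_iff hobs hP.isHermitian.inv xh z u).1 hu⟩

theorem IsMinimizer.eq [Nontrivial (E nx)] (hobs : obs.Standing) {c₁ : ℝ} (hc₁ : 0 ≤ c₁)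
    {P : Matrix (Fin nx) (Fin nx) ℝ} (hP : P.PosDef) {xh : E nx} {z : E nz} {u u' : E nu}
    (hu : IsMinimizer sys obs h α πn c₁ Δt P xh z u)
    (hu' : IsMinimizer sys obs h α πn c₁ Δt P xh z u') : u = u' :=
  ProgramData.IsSol.eq hc₁ ((isSol_programData_iff hobs hP.isHermitian.inv xh z u).2 hu)
    ((isSol_programData_iff hobs hP.isHermitian.inv xh z u').2 hu')

theorem tendsto_toParam {ι : Type*} {l : Filter ι} {A : ι → Matrix (Fin nx) (Fin nx) ℝ}
    {P : Matrix (Fin nx) (Fin nx) ℝ} (hP : P.PosDef) (hA : Tendsto A l (𝓝 P)) (xh : E nx)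
    (z : E nz) : Tendsto (fun i => toParam (A i) xh z) l (𝓝 (toParam P xh z)) :=
  hA.prodMk_nhds (((continuousAt_inv_of_posDef hP).tendsto.comp hA).prodMk_nhds tendsto_const_nhds)

/-- The minimizer depends continuously on the uncertainty. -/
theorem tendsto_isMinimizer [Nontrivial (E nx)] (hsys : sys.Standing) (hobs : obs.Standing)
    (hh : ∀ x ∈ sys.X ∪ sys.Xhat, ContDiffAt ℝ 2 h x)
    (hπn : ∃ K : ℝ≥0, LipschitzOnWith K πn sys.Xhat) {c₁ : ℝ} (hc₁ : 0 ≤ c₁) {xh : E nx}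
    (hxh : xh ∈ sys.Xhat) (hrel : lieG sys h xh ≠ 0) {z : E nz} {ι : Type*} {l : Filter ι}
    {A : ι → Matrix (Fin nx) (Fin nx) ℝ} (hApos : ∀ᶠ i in l, (A i).PosDef)
    {P : Matrix (Fin nx) (Fin nx) ℝ} (hP : P.PosDef) (hA : Tendsto A l (𝓝 P)) {υ : ι → E nu}
    (hυ : ∀ᶠ i in l, IsMinimizer sys obs h α πn c₁ Δt (A i) xh z (υ i)) {u : E nu}
    (hu : IsMinimizer sys obs h α πn c₁ Δt P xh z u) : Tendsto υ l (𝓝 u) := by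
  have hreg := regular_programData (α := α) (πn := πn) (Δt := Δt) hobs (p := toParam P xh z)
    hP.isHermitian.inv hrel
  have hdata : Tendsto (fun i => programData sys obs h α πn Δt (toParam (A i) xh z)) l
      (𝓝 (programData sys obs h α πn Δt (toParam P xh z))) := by
    have hcont := (locallyLipschitzOn_programData (obs := obs) (α := α) (Δt := Δt) hsys hh
      hπn).continuousOn (toParam P xh z) hxh
    exact hcont.tendsto.comp (tendsto_nhdsWithin_iff.2
      ⟨tendsto_toParam hP hA xh z, Eventually.of_forall fun _ => hxh⟩)
  refine ProgramData.tendsto_isSol hc₁ hreg.normal_ne hdata ?_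
    ((isSol_programData_iff hobs hP.isHermitian.inv xh z u).2 hu)
  filter_upwards [hApos, hυ] with i hi hi'
  exact (isSol_programData_iff hobs hi.isHermitian.inv xh z _).2 hi'

theorem UncertaintyBounds.posDef {I : Set ℝ} {pLow pHigh : ℝ}
    {P : ℝ → Matrix (Fin nx) (Fin nx) ℝ} (hP : UncertaintyBounds I pLow pHigh P)
    (hpLow : 0 < pLow) {t : ℝ} (ht : t ∈ I) : (P t).PosDef :=
  posDef_of_sub_smul_one hpLow (hP t ht).1

theorem UncertaintyBounds.posDef_of_tendsto {I : Set ℝ} {pLow pHigh : ℝ}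
    {P : ℝ → Matrix (Fin nx) (Fin nx) ℝ} (hP : UncertaintyBounds I pLow pHigh P)
    (hpLow : 0 < pLow) {l : Filter ℝ} [l.NeBot] (hl : ∀ᶠ t in l, t ∈ I)
    {A : Matrix (Fin nx) (Fin nx) ℝ} (hA : Tendsto P l (𝓝 A)) : A.PosDef :=
  posDef_of_sub_smul_one hpLow <|
    isClosed_posSemidef.mem_of_tendsto (hA.sub_const _) (hl.mono fun t ht => (hP t ht).1)

/-- The controller inherits piecewise continuity from the uncertainty.  One-sided limits of the
uncertainty are positive definite, and the program is well posed at them. -/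
theorem piecewiseContinuous_controller [Nontrivial (E nx)] (hsys : sys.Standing)
    (hobs : obs.Standing) (hh : ∀ x ∈ sys.X ∪ sys.Xhat, ContDiffAt ℝ 2 h x)
    (hπn : ∃ K : ℝ≥0, LipschitzOnWith K πn sys.Xhat) {c₁ : ℝ} (hc₁ : 0 ≤ c₁) {xh : E nx}
    (hxh : xh ∈ sys.Xhat) (hrel : lieG sys h xh ≠ 0) {z : E nz} {I : Set ℝ} {pLow pHigh : ℝ}
    {P : ℝ → Matrix (Fin nx) (Fin nx) ℝ} (hPbd : UncertaintyBounds I pLow pHigh P)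
    (hpLow : 0 < pLow) (hP : PiecewiseContinuous I P) {υ : ℝ → E nu}
    (hυ : ∀ t ∈ I, IsMinimizer sys obs h α πn c₁ Δt (P t) xh z (υ t)) :
    PiecewiseContinuous I υ := by
  have side : ∀ (t : ℝ) (s : Set ℝ), (∃ A, Tendsto P (𝓝[I ∩ s] t) (𝓝 A)) →
      ∃ u, Tendsto υ (𝓝[I ∩ s] t) (𝓝 u) := by
    rintro t s ⟨A, hA⟩
    rcases (𝓝[I ∩ s] t).eq_or_neBot with hbot | hne
    · exact ⟨0, hbot ▸ tendsto_bot⟩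
    have hmem : ∀ᶠ t' in 𝓝[I ∩ s] t, t' ∈ I := eventually_mem_nhdsWithin.mono fun _ h => h.1
    have hApos := hPbd.posDef_of_tendsto hpLow hmem hA
    obtain ⟨u, hu⟩ := exists_isMinimizer (α := α) (πn := πn) (Δt := Δt) hobs hc₁ hApos hrel z
    exact ⟨u, tendsto_isMinimizer hsys hobs hh hπn hc₁ hxh hrel
      (hmem.mono fun _ => hPbd.posDef hpLow) hApos hA (hmem.mono hυ) hu⟩
  obtain ⟨⟨D, hD, hcont⟩, hlim⟩ := hP
  refine ⟨⟨D, hD, fun t ht => ?_⟩, fun t ht => ⟨side t _ (hlim t ht).1, side t _ (hlim t ht).2⟩⟩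
  exact tendsto_isMinimizer hsys hobs hh hπn hc₁ hxh hrel
    (eventually_mem_nhdsWithin.mono fun _ => hPbd.posDef hpLow) (hPbd.posDef hpLow ht.1)
    (hcont t ht) (eventually_mem_nhdsWithin.mono hυ) (hυ t ht.1)

/-- Lipschitz continuity of the controller in the estimate and the output, uniformly in time. -/
theorem exists_lipschitzOnWith_controller [Nontrivial (E nx)] (hsys : sys.Standing)
    (hobs : obs.Standing) (hh : ∀ x ∈ sys.X ∪ sys.Xhat, ContDiffAt ℝ 2 h x)
    (hπn : ∃ K : ℝ≥0, LipschitzOnWith K πn sys.Xhat) {c₁ : ℝ} (hc₁ : 0 ≤ c₁)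
    (hrel : ∀ xh ∈ sys.Xhat, lieG sys h xh ≠ 0)
    {P : ℝ → Matrix (Fin nx) (Fin nx) ℝ} {J : Set ℝ} (hJ : IsCompact J) (hPJ : ContinuousOn P J)
    (hPpos : ∀ t ∈ J, (P t).PosDef) {π : ℝ → E nx → E nz → E nu}
    (hπ : ∀ t ∈ J, ∀ xh ∈ sys.Xhat, ∀ z, IsMinimizer sys obs h α πn c₁ Δt (P t) xh z (π t xh z))
    (hdist : ∀ t ∈ J, ∀ xh ∈ sys.Xhat, ∀ z,
      DistinctEigenvalues (nextS sys obs Δt (P t)⁻¹ xh (π t xh z)))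
    {Z : Set (E nz)} (hZ : Bornology.IsBounded Z) :
    ∃ L : ℝ≥0, ∀ t ∈ J,
      LipschitzOnWith L (fun p : E nx × E nz => π t p.1 p.2) (sys.Xhat ×ˢ Z) := by
  set T : Set (ℝ × E nx × E nz) := J ×ˢ sys.Xhat ×ˢ closure Z with hT
  have hTc : IsCompact T := hJ.prod (hsys.isCompact_Xhat.prod hZ.isCompact_closure)
  have hparam : ContinuousOn (fun p : ℝ × E nx × E nz => toParam (P p.1) p.2.1 p.2.2) T := by
    have h1 : ContinuousOn (fun p : ℝ × E nx × E nz => P p.1) T :=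
      hPJ.comp continuousOn_fst fun p hp => hp.1
    have h2 : ContinuousOn (fun p : ℝ × E nx × E nz => (P p.1)⁻¹) T := fun p hp =>
      (continuousAt_inv_of_posDef (hPpos p.1 hp.1)).tendsto.comp (h1 p hp)
    exact h1.prodMk (h2.prodMk (continuousOn_snd.fst.prodMk continuousOn_snd.snd))
  set K : Set (Param nx nz) := (fun p : ℝ × E nx × E nz => toParam (P p.1) p.2.1 p.2.2) '' T
  have hK : IsCompact K := hTc.image_of_continuousOn hparam
  have hKX : K ⊆ {p : Param nx nz | p.2.2.1 ∈ sys.Xhat} := by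
    rintro _ ⟨p, hp, rfl⟩
    exact hp.2.1
  have hloc :=
    (locallyLipschitzOn_programData (obs := obs) (α := α) (Δt := Δt) hsys hh hπn).mono hKX
  obtain ⟨L₁, hL₁⟩ := LocallyLipschitzOn.exists_lipschitzOnWith_of_compact
    (α := Param nx nz) (β := ProgramData (E nu) (E nx)) hK hloc
  set Φ := programData sys obs h α πn Δt
  -- On the data that occur, the solution of the program is a function of the data alone.
  have hsolΦ : ∀ t ∈ J, ∀ xh ∈ sys.Xhat, ∀ z, (Φ (toParam (P t) xh z)).IsSol c₁ (π t xh z) :=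
    fun t ht xh hxh z =>
      (isSol_programData_iff hobs (hPpos t ht).isHermitian.inv xh z _).2 (hπ t ht xh hxh z)
  set σ : ProgramData (E nu) (E nx) → E nu := fun d => Classical.epsilon fun u => d.IsSol c₁ u
  have hσ : ∀ t ∈ J, ∀ xh ∈ sys.Xhat, ∀ z, σ (Φ (toParam (P t) xh z)) = π t xh z :=
    fun t ht xh hxh z =>
      ProgramData.IsSol.eq hc₁ (Classical.epsilon_spec ⟨_, hsolΦ t ht xh hxh z⟩)
        (hsolΦ t ht xh hxh z)
  obtain ⟨L₂, hL₂⟩ : ∃ L : ℝ≥0, LipschitzOnWith L σ (Φ '' K) := by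
    refine ProgramData.exists_lipschitzOnWith hc₁ (hK.image_of_continuousOn hloc.continuousOn)
      ?_ ?_ ?_
    · rintro _ ⟨_, ⟨⟨t, xh, z⟩, ⟨ht, hxh, -⟩, rfl⟩, rfl⟩
      exact regular_programData hobs (hPpos t ht).isHermitian.inv (hrel xh hxh)
    · rintro _ ⟨_, ⟨⟨t, xh, z⟩, ⟨ht, hxh, -⟩, rfl⟩, rfl⟩
      exact (hσ t ht xh hxh z).symm ▸ hsolΦ t ht xh hxh z
    · rintro _ ⟨_, ⟨⟨t, xh, z⟩, ⟨ht, hxh, -⟩, rfl⟩, rfl⟩ v y hv hy hvy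
      simp only [hσ t ht xh hxh z, Φ, pencil_programData] at hv ⊢
      exact (hdist t ht xh hxh z).minRayleigh_lt hv hy hvy
  refine ⟨L₂ * (L₁ * 1), fun t ht => ?_⟩
  have hΨ : LipschitzOnWith 1 (fun p : E nx × E nz => toParam (P t) p.1 p.2) (sys.Xhat ×ˢ Z) := by
    have h1 : LipschitzWith 1 fun p : E nx × E nz =>
        (Matrix.of.symm (P t), Matrix.of.symm (P t)⁻¹, p) := by
      simpa [Function.comp_def] using (LipschitzWith.prodMk_left (Matrix.of.symm (P t))).comp
        (LipschitzWith.prodMk_left (β := E nx × E nz) (Matrix.of.symm (P t)⁻¹))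
    exact h1.lipschitzOnWith
  have hmaps : MapsTo (fun p : E nx × E nz => toParam (P t) p.1 p.2) (sys.Xhat ×ˢ Z) K :=
    fun p hp => ⟨(t, p), ⟨ht, hp.1, subset_closure hp.2⟩, rfl⟩
  have hcomp := hL₂.comp (hL₁.comp hΨ hmaps) fun p hp => mem_image_of_mem Φ (hmaps hp)
  intro p hp p' hp'
  have := hcomp hp hp'
  simpa only [Function.comp_apply, hσ t ht _ hp.1, hσ t ht _ hp'.1] using this

end Controller

/-! ### Safety -/

section Safety

/-- A continuous function with nonnegative derivative off a finite set does not decrease. -/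
theorem le_of_hasDerivAt_nonneg_off_finite {φ : ℝ → ℝ} (D : Finset ℝ) :
    ∀ {a b : ℝ}, a ≤ b → ContinuousOn φ (Icc a b) →
      (∀ t ∈ Ioo a b, t ∉ D → ∃ m, 0 ≤ m ∧ HasDerivAt φ m t) → φ a ≤ φ b := by
  induction D using Finset.induction_on with
  | empty =>
    intro a b hab hc hd
    refine monotoneOn_of_deriv_nonneg (convex_Icc a b) hc ?_ ?_ (left_mem_Icc.2 hab)
      (right_mem_Icc.2 hab) hab
    · intro t ht
      rw [interior_Icc] at ht
      obtain ⟨m, -, hm⟩ := hd t ht (Finset.notMem_empty t)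
      exact hm.differentiableAt.differentiableWithinAt
    · intro t ht
      rw [interior_Icc] at ht
      obtain ⟨m, hm0, hm⟩ := hd t ht (Finset.notMem_empty t)
      exact hm.deriv ▸ hm0
  | insert d D _ ih =>
    intro a b hab hc hd
    by_cases hdab : d ∈ Ioo a b
    · refine (ih hdab.1.le (hc.mono (Icc_subset_Icc_right hdab.2.le)) fun t ht htD => ?_).trans
        (ih hdab.2.le (hc.mono (Icc_subset_Icc_left hdab.1.le)) fun t ht htD => ?_)
      · exact hd t ⟨ht.1, ht.2.trans hdab.2⟩ (by simp [htD, ht.2.ne])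
      · exact hd t ⟨hdab.1.trans ht.1, ht.2⟩ (by simp [htD, ht.1.ne'])
    · refine ih hab hc fun t ht htD => hd t ht ?_
      rw [Finset.mem_insert, not_or]
      exact ⟨fun h => hdab (h ▸ ht), htD⟩

theorem Icc_subset_timeInterval {tmax : EReal} {t : ℝ} (ht : t ∈ timeInterval tmax) :
    Icc 0 t ⊆ timeInterval tmax := fun _ hs =>
  ⟨hs.1, (EReal.coe_le_coe_iff.2 hs.2).trans_lt ht.2⟩

variable {nx nu nz : ℕ} {sys : Plant nx nu nz} {obs : ObserverParams nx nz} {h : E nx → ℝ} {α : ℝ}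

/-- If the control satisfies the barrier constraint at the estimate, `h` decays at the estimate at
most exponentially with rate `α`: the constraint says that the derivative of `exp (α t) * h` along
the estimate is nonnegative. -/
theorem IsTrajectory.exp_le_of_feasible {tmax : EReal}
    (hh : ∀ x ∈ sys.X ∪ sys.Xhat, ContDiffAt ℝ 2 h x) {u : ℝ → E nu} {x xh : ℝ → E nx}
    {P : ℝ → Matrix (Fin nx) (Fin nx) ℝ} (htraj : IsTrajectory sys obs (timeInterval tmax) u x xh P)
    (hu : ∀ t ∈ timeInterval tmax, u t ∈ cbfFeasible sys obs h α (P t) (xh t) (sys.q (x t)))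
    {t : ℝ} (ht : t ∈ timeInterval tmax) : h (xh 0) * Real.exp (-α * t) ≤ h (xh t) := by
  have hsub := Icc_subset_timeInterval ht
  have hcont : ContinuousOn (fun s => Real.exp (α * s) * h (xh s)) (Icc 0 t) := by
    refine (Continuous.continuousOn (by fun_prop)).mul fun s hs => ?_
    exact ((hh _ (Or.inr (htraj.xh_mem s (hsub hs)))).continuousAt).comp_continuousWithinAt
      ((htraj.xh_cont s (hsub hs)).mono hsub)
  obtain ⟨D, hD, hode⟩ := htraj.ode
  have key := le_of_hasDerivAt_nonneg_off_finite (hD t ht).toFinset ht.1 hcont fun s hs hsD => by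
    have hsI : s ∈ timeInterval tmax := hsub ⟨hs.1.le, hs.2.le⟩
    have hsD' : s ∉ D := fun hmem => hsD <| by
      rw [Set.Finite.mem_toFinset]
      exact ⟨hmem, hs.1.le, hs.2.le⟩
    have hnhds : timeInterval tmax ∈ 𝓝 s :=
      mem_of_superset (Icc_mem_nhds hs.1 hs.2) hsub
    have hxh := ((hode s ⟨hsI, hsD'⟩).2.1).hasDerivAt hnhds
    have hhd : HasFDerivAt h (fderiv ℝ h (xh s)) (xh s) :=
      ((hh _ (Or.inr (htraj.xh_mem s hsI))).differentiableAt (by norm_num)).hasFDerivAt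
    have hexp : HasDerivAt (fun s => Real.exp (α * s)) (Real.exp (α * s) * (α * 1)) s :=
      ((hasDerivAt_id s).const_mul α).exp
    refine ⟨_, ?_, hexp.mul (hhd.comp_hasDerivAt s hxh)⟩
    have hfeas := hu s hsI
    simp only [cbfFeasible, mem_ofPred_eq, lieF, lieG, LinearMap.comp_apply] at hfeas
    have e : Real.exp (α * s) * (α * 1) * h (xh s) + Real.exp (α * s) *
        fderiv ℝ h (xh s) (dynamics sys (xh s) (u s)
          + injection sys obs (P s) (xh s) (sys.q (x s))) =
        Real.exp (α * s) * (fderiv ℝ h (xh s) (sys.f (xh s))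
          + fderiv ℝ h (xh s) (Matrix.toEuclideanLin (sys.g (xh s)) (u s)) + α * h (xh s)
          + fderiv ℝ h (xh s) (injection sys obs (P s) (xh s) (sys.q (x s)))) := by
      rw [dynamics, map_add, map_add]; ring
    exact (mul_nonneg (Real.exp_pos _).le hfeas).trans_eq e.symm
  simp only [mul_zero, Real.exp_zero, one_mul] at key
  have h1 := mul_le_mul_of_nonneg_right key (Real.exp_pos (-α * t)).le
  rwa [mul_right_comm, ← Real.exp_add, ← add_mul, add_neg_cancel, zero_mul, Real.exp_zero,
    one_mul] at h1

/-- A control that satisfies the barrier constraint at the estimate keeps the state safe, because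
the error bound decays at least as fast as the barrier function can, and the barrier function
starts above it. -/
theorem IsTrajectory.mem_safeSet {tmax : EReal} (htmax : 0 < tmax)
    (hh : ∀ x ∈ sys.X ∪ sys.Xhat, ContDiffAt ℝ 2 h x) {Kh : ℝ≥0}
    (hKh : LipschitzOnWith Kh h (sys.X ∪ sys.Xhat)) {θ M : ℝ} (hαθ : α ≤ θ) (hM : 0 ≤ M)
    {u : ℝ → E nu} {x xh : ℝ → E nx}
    {P : ℝ → Matrix (Fin nx) (Fin nx) ℝ} (htraj : IsTrajectory sys obs (timeInterval tmax) u x xh P)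
    (hu : ∀ t ∈ timeInterval tmax, u t ∈ cbfFeasible sys obs h α (P t) (xh t) (sys.q (x t)))
    (herr : ∀ t ∈ timeInterval tmax, ‖x t - xh t‖ ≤ M * Real.exp (-θ * t))
    (h0 : 2 * Kh * M ≤ h (x 0)) {t : ℝ} (ht : t ∈ timeInterval tmax) : x t ∈ safeSet sys h := by
  refine ⟨htraj.x_mem t ht, ?_⟩
  have hmem0 : (0 : ℝ) ∈ timeInterval tmax := ⟨le_rfl, by simpa using htmax⟩
  have hlip : ∀ s ∈ timeInterval tmax, |h (x s) - h (xh s)| ≤ Kh * (M * Real.exp (-θ * s)) :=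
    fun s hs => by
      have h1 := hKh.norm_sub_le (Or.inl (htraj.x_mem s hs)) (Or.inr (htraj.xh_mem s hs))
      exact h1.trans (mul_le_mul_of_nonneg_left (herr s hs) Kh.2)
  have h1 := (abs_le.1 (hlip 0 hmem0)).2
  rw [mul_zero, Real.exp_zero, mul_one] at h1
  have h2 : Kh * M ≤ h (xh 0) := by linarith
  have h3 := htraj.exp_le_of_feasible hh hu ht
  have h4 := (abs_le.1 (hlip t ht)).1
  have h5 : Real.exp (-θ * t) ≤ Real.exp (-α * t) :=
    Real.exp_le_exp.2 (mul_le_mul_of_nonneg_right (neg_le_neg hαθ) ht.1)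
  have hKM : 0 ≤ Kh * M := mul_nonneg Kh.2 hM
  have h6 : Kh * M * Real.exp (-θ * t) ≤ h (xh 0) * Real.exp (-α * t) :=
    mul_le_mul h2 h5 (Real.exp_pos _).le (hKM.trans h2)
  linarith

end Safety

end ConfidenceCBF

/-! ### The controller of the confidence-aware program -/

theorem theorem4 {nx nu nz : ℕ} (sys : Plant nx nu nz) (hsys : sys.Standing)
    (obs : ObserverParams nx nz) (hobs : obs.Standing)
    (tmax : EReal) (htmax : 0 < tmax)
    -- bounds of the uncertainty, lower bound of `R`, and the known error bound
    (pLow pHigh rLow : ℝ) (hpLow : 0 < pLow) (hpHigh : 0 < pHigh) (hrLow : 0 < rLow)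
    (hR : (obs.R - rLow • (1 : Matrix (Fin nz) (Fin nz) ℝ)).PosSemidef)
    (ε η θ : ℝ) (hErr : KnownErrorBound sys obs (timeInterval tmax) pLow pHigh ε η θ)
    -- the barrier function, of relative degree one, and the initial conditions
    (h : E nx → ℝ) (Kh Kq : ℝ≥0)
    (hKh : LipschitzOnWith Kh h (sys.X ∪ sys.Xhat))
    (hKq : LipschitzOnWith Kq sys.q (sys.X ∪ sys.Xhat))
    (hKq' : ∀ x ∈ sys.X ∪ sys.Xhat, ‖fderiv ℝ sys.q x‖ ≤ Kq)
    (α : ℝ) (x₀ xh₀ : E nx)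
    (hCBF : IsCBF sys h α θ (η * ‖x₀ - xh₀‖) pHigh rLow Kh Kq)
    (hrel : ∀ x ∈ sys.X ∪ sys.Xhat, lieG sys h x ≠ 0)
    (hx₀ : x₀ ∈ safeSet sys h) (hhx₀ : 2 * Kh * (η * ‖x₀ - xh₀‖) ≤ h x₀)
    (hxh₀ : xh₀ ∈ sys.Xhat) (hζ₀ : ‖x₀ - xh₀‖ < ε)
    -- the nominal controller and the weights
    (πn : E nx → E nu) (hπn : ∃ K : ℝ≥0, LipschitzOnWith K πn sys.Xhat)
    (c₁ Δt : ℝ) (hc₁ : 0 ≤ c₁) (hΔt : 0 < Δt)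
    -- the uncertainty `P`, with confidence `S = P⁻¹`
    (P : ℝ → Matrix (Fin nx) (Fin nx) ℝ)
    (hPcont : PiecewiseContinuous (timeInterval tmax) P)
    (hPbd : UncertaintyBounds (timeInterval tmax) pLow pHigh P)
    -- distinct eigenvalues of `S(t)` and of the predicted `S(t + Δt)` under the chosen control
    (hdist : ∀ t ∈ timeInterval tmax, DistinctEigenvalues (P t)⁻¹)
    (hdist' : ∀ t ∈ timeInterval tmax, ∀ xh ∈ sys.Xhat, ∀ z u,
      IsMinimizer sys obs h α πn c₁ Δt (P t) xh z u →
        DistinctEigenvalues (nextS sys obs Δt (P t)⁻¹ xh u)) :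
    -- feasibility, existence and uniqueness of the minimizer
    (∀ t ∈ timeInterval tmax, ∀ xh ∈ sys.Xhat, ∀ z,
      (cbfFeasible sys obs h α (P t) xh z).Nonempty ∧
        ∃! u, IsMinimizer sys obs h α πn c₁ Δt (P t) xh z u) ∧
    -- properties of the resulting controller
    ∀ π : ℝ → E nx → E nz → E nu,
      (∀ t ∈ timeInterval tmax, ∀ xh ∈ sys.Xhat, ∀ z,
        IsMinimizer sys obs h α πn c₁ Δt (P t) xh z (π t xh z)) →
      -- piecewise continuity in `t`
      (∀ xh ∈ sys.Xhat, ∀ z, PiecewiseContinuous (timeInterval tmax) fun t => π t xh z) ∧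
      -- Lipschitz continuity in `(xh, z)`, for `z` in bounded sets, locally uniformly in time
      (∀ J ⊆ timeInterval tmax, IsCompact J → ContinuousOn P J →
        ∀ Z : Set (E nz), Bornology.IsBounded Z →
          ∃ L : ℝ≥0, ∀ t ∈ J,
            LipschitzOnWith L (fun p : E nx × E nz => π t p.1 p.2) (sys.Xhat ×ˢ Z)) ∧
      -- safety
      RendersSafe sys obs (timeInterval tmax) P h x₀ xh₀ π := by
  have hmem0 : (0 : E nx) ∈ sys.X ∪ sys.Xhat := Or.inl hsys.zero_mem_X
  have : Nontrivial (E nx) := nontrivial_of_lieG_ne_zero (hrel 0 hmem0)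
  have hrel' : ∀ xh ∈ sys.Xhat, lieG sys h xh ≠ 0 := fun xh hxh => hrel xh (Or.inr hxh)
  have hPpos : ∀ t ∈ timeInterval tmax, (P t).PosDef := fun t ht => hPbd.posDef hpLow ht
  refine ⟨fun t ht xh hxh z => ?_, fun π hπ => ⟨fun xh hxh z => ?_, ?_, ?_⟩⟩
  · obtain ⟨u, hu⟩ := exists_isMinimizer (α := α) (πn := πn) (Δt := Δt) hobs hc₁ (hPpos t ht)
      (hrel' xh hxh) z
    exact ⟨⟨u, hu.1⟩, u, hu, fun v hv => hv.eq hobs hc₁ (hPpos t ht) hu⟩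
  · exact piecewiseContinuous_controller hsys hobs hCBF.smooth hπn hc₁ hxh (hrel' xh hxh) hPbd hpLow
      hPcont fun t ht => hπ t ht xh hxh z
  · intro J hJI hJ hPJ Z hZ
    exact exists_lipschitzOnWith_controller hsys hobs hCBF.smooth hπn hc₁ hrel' hJ hPJ
      (fun t ht => hPpos t (hJI ht)) (fun t ht => hπ t (hJI ht))
      (fun t ht xh hxh z => hdist' t (hJI ht) xh hxh z _ (hπ t (hJI ht) xh hxh z)) hZ
  · intro x xh htraj hx hxh t ht
    refine htraj.mem_safeSet htmax hCBF.smooth hKh hCBF.α_le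
      (mul_nonneg hErr.η_pos.le (norm_nonneg (x₀ - xh₀)))
      (fun s hs => (hπ s hs _ (htraj.xh_mem s hs) _).1) ?_ (hx ▸ hhx₀) ht
    intro s hs
    have := hErr.bound _ x xh P htraj hPbd (by rwa [hx, hxh]) s hs
    rwa [hx, hxh] at this
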